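/- Let $G$ be a finite group with subgroups $H_1,H_2$. Let $M_0$ be a compact connected smooth $n$-manifold (Hausdorff, without boundary) with a smooth Riemannian metric $g_0$. Let $M$ be a compact smooth $n$-manifold on which $G$ acts freely by diffeomorphisms, let $\pi:M\to M_0=G\backslash M$ and $\pi_i:M\to M_i=H_i\backslash M$ ($i=1,2$) be the smooth quotient coverings, and let $p_i:M_i\to M_0$ be the induced smooth coverings, $p_i\circ\pi_i=\pi$. Put $g=\pi^*g_0$ on $M$ and $g_i=p_i^*g_0$ on $M_i$. Let $S^*M=\{(x,\xi)\in T^*M:|\xi|_g=1\}$ and $S^*M_i=\{(x,\xi)\in T^*M_i:|\xi|_{g_i}=1\}$ be the unit cosphere bundles, and let $\mu_{L_i}$ be the Liouville measure on $S^*M_i$ (the quotient of the symplectic volume of $T^*M_i$ by $dH$, $H=\tfrac12|\xi|_{g_i}^2$). Let $\widetilde\pi_i:S^*M\to S^*M_i$, $\widetilde\pi_i(x,\xi)=(\pi_i(x),\,\xi\circ(d\pi_i)_x^{-1})$, be the lifted coverings, and for $a\in G$ let $\widetilde T_a(x,\xi)=(a\cdot x,(a^{-1})^*\xi)$ be the lifted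 deck transformation of $S^*M$. Write $\widetilde T_a$ also for the translation operator $\widetilde T_af=f\circ\widetilde T_{a^{-1}}$ on functions on $S^*M$. Let $\widetilde\pi_1^*F=F\circ\widetilde\pi_1$, and let $(\widetilde\pi_{2*}f)(\eta)=\sum_{\zeta\in\widetilde\pi_2^{-1}(\eta)}f(\zeta)$. Let $\mathcal A:L^2(G/H_1)\to L^2(G/H_2)$ (counting measures) be a unitary operator that intertwines the permutation representations $(a\cdot f)(xH_i)=f(a^{-1}xH_i)$ of $G$. Then there is exactly one function $A:H_2\backslash G/H_1\to\mathbb C$ with $$(\mathcal Af)(xH_2)=\sum_{y\in G}A(x^{-1}y)\,f(yH_1)\qquad (x\in G,\ f\in L^2(G/H_1)),$$ and, for this convolution kernel $A$, the lifted finite Radon transform $$\widetilde U_A=\frac1{\#H_1}\sum_{a\in G}A(a)\,\widetilde\pi_{2*}\,\widetilde T_a\,\widetilde\pi_1^{*}:\;L^2(S^*M_1,d\mu_{L_1})\to L^2(S^*M_2,d\mu_{L_2})$$ is well defined and is a unitary operator, that is, a linear isometry onto $L^2(S^*M_2,d\mu_{L_2})$. The same holds if both Liouville measures are normalized to total mass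 one. -/

import Mathlib

open scoped Manifold ContDiff ENNReal
open MeasureTheory

noncomputable section

namespace FiniteRadon

/-! ### Cotangent and unit cosphere bundles -/

section Manifold

variable {n : ℕ}

/-- The cotangent space `T_x^*M` (with `M` of dimension `n`). -/
abbrev CotangentSpace (n : ℕ) {M : Type*} [TopologicalSpace M]
    [ChartedSpace (EuclideanSpace ℝ (Fin n)) M] (x : M) : Type :=
  TangentSpace (𝓡 n) x →L[ℝ] Bundle.Trivial M ℝ x

/-- The cotangent bundle `T^*M`, with Mathlib's topology of the dual of the tangent bundle. -/
abbrev CotangentBundle (n : ℕ) (M : Type*) [TopologicalSpace M]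
    [ChartedSpace (EuclideanSpace ℝ (Fin n)) M] : Type _ :=
  Bundle.TotalSpace (EuclideanSpace ℝ (Fin n) →L[ℝ] ℝ) (fun x : M => CotangentSpace n x)

/-- A field of real-valued functions of two tangent vectors; the fields used are Riemannian metrics
and their pullbacks along local diffeomorphisms. -/
abbrev FormField (n : ℕ) (M : Type*) [TopologicalSpace M]
    [ChartedSpace (EuclideanSpace ℝ (Fin n)) M] : Type _ :=
  ∀ x : M, TangentSpace (𝓡 n) x → TangentSpace (𝓡 n) x → ℝ

variable {M : Type*} [TopologicalSpace M] [ChartedSpace (EuclideanSpace ℝ (Fin n)) M]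
  {N : Type*} [TopologicalSpace N] [ChartedSpace (EuclideanSpace ℝ (Fin n)) N]
  {P : Type*} [TopologicalSpace P] [ChartedSpace (EuclideanSpace ℝ (Fin n)) P]

/-- The pullback `p^*g`, that is `(p^*g)_x(v, w) = g_{p x}(dp v, dp w)`. -/
def pullbackForm (p : M → N) (g : FormField n N) : FormField n M :=
  fun x v w => g (p x) (mfderiv (𝓡 n) (𝓡 n) p x v) (mfderiv (𝓡 n) (𝓡 n) p x w)

lemma pullbackForm_apply (p : M → N) (g : FormField n N) (x : M)
    (v w : TangentSpace (𝓡 n) x) :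
    pullbackForm p g x v w
      = g (p x) (mfderiv (𝓡 n) (𝓡 n) p x v) (mfderiv (𝓡 n) (𝓡 n) p x w) := rfl

lemma pullbackForm_comp {p : N → P} {q : M → N} {r : M → P} (hr : p ∘ q = r)
    (hp : IsLocalDiffeomorph (𝓡 n) (𝓡 n) ∞ p) (hq : IsLocalDiffeomorph (𝓡 n) (𝓡 n) ∞ q)
    (g : FormField n P) : pullbackForm q (pullbackForm p g) = pullbackForm r g := by
  subst hr
  funext x v w
  have h := mfderiv_comp x (hp.mdifferentiable (by simp) (q x)) (hq.mdifferentiable (by simp) x)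
  rw [pullbackForm_apply, pullbackForm_apply, pullbackForm_apply, h]
  rfl

/-- The norm of a covector, dual to the norm of `g` on tangent vectors:
`|ξ|_g = sup {ξ(v) : g(v, v) ≤ 1}`. -/
def conorm (g : FormField n M) (x : M) (ξ : CotangentSpace n x) : ℝ :=
  sSup {t : ℝ | ∃ v : TangentSpace (𝓡 n) x, g x v v ≤ 1 ∧ ξ v = t}

lemma conorm_smul (g : FormField n M) (x : M) {c : ℝ} (hc : 0 ≤ c) (ξ : CotangentSpace n x) :
    conorm g x (c • ξ) = c * conorm g x ξ := by
  unfold conorm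
  rw [← smul_eq_mul, ← Real.sSup_smul_of_nonneg hc]
  congr 1
  ext t
  simp only [Set.mem_ofPred_eq, Set.mem_smul_set]
  constructor
  · rintro ⟨v, hv, rfl⟩
    exact ⟨ξ v, ⟨v, hv, rfl⟩, rfl⟩
  · rintro ⟨_, ⟨v, hv, rfl⟩, rfl⟩
    exact ⟨v, hv, rfl⟩

/-- The map `T^*M → T^*N`, `(x, ξ) ↦ (p x, (dp_x^{-1})^* ξ)` induced by a local
diffeomorphism `p`. -/
def cotangentLift (p : M → N) (z : CotangentBundle n M) : CotangentBundle n N :=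
  ⟨p z.1, z.2 ∘L (mfderiv (𝓡 n) (𝓡 n) p z.1).inverse⟩

lemma conorm_cotangentLift {p : M → N} (hp : IsLocalDiffeomorph (𝓡 n) (𝓡 n) ∞ p)
    (g : FormField n N) (z : CotangentBundle n M) :
    conorm g (cotangentLift p z).1 (cotangentLift p z).2 = conorm (pullbackForm p g) z.1 z.2 := by
  have he := hp.mfderivToContinuousLinearEquiv_coe (by simp) z.1
  set e := hp.mfderivToContinuousLinearEquiv (by simp) z.1
  have hinv : (mfderiv (𝓡 n) (𝓡 n) p z.1).inverse = (e.symm : _ →L[ℝ] _) := by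
    rw [← he]; exact ContinuousLinearMap.inverse_equiv e
  have hpe : ∀ v, mfderiv (𝓡 n) (𝓡 n) p z.1 v = e v := fun v => by rw [← he]; rfl
  unfold conorm
  congr 1
  ext t
  constructor
  · rintro ⟨w, hw, hwt⟩
    refine ⟨e.symm w, ?_, ?_⟩
    · rw [pullbackForm_apply, hpe]
      have hew : e (e.symm w) = w := e.apply_symm_apply w
      exact (congrArg (fun u => g (p z.1) u u) hew).trans_le hw
    · rw [← hwt]
      show _ = z.2 ((mfderiv (𝓡 n) (𝓡 n) p z.1).inverse w)
      rw [hinv]; rfl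
  · rintro ⟨v, hv, hvt⟩
    rw [pullbackForm_apply, hpe] at hv
    refine ⟨e v, hv, ?_⟩
    rw [← hvt]
    show z.2 ((mfderiv (𝓡 n) (𝓡 n) p z.1).inverse (e v)) = _
    rw [hinv]
    exact congrArg z.2 (e.symm_apply_apply v)

/-- The unit cosphere bundle `S^*_g M = {(x, ξ) ∈ T^*M : |ξ|_g = 1}`. -/
def CosphereBundle (g : FormField n M) : Type _ :=
  {z : CotangentBundle n M // conorm g z.1 z.2 = 1}

/-- The map `S^*_{p^*g} M → S^*_g N`, `(x, ξ) ↦ (p x, (dp_x^{-1})^* ξ)` induced by a local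
diffeomorphism `p`, which is a local isometry for these metrics. -/
def cosphereLift (p : M → N) (hp : IsLocalDiffeomorph (𝓡 n) (𝓡 n) ∞ p)
    {gM : FormField n M} {gN : FormField n N} (hg : pullbackForm p gN = gM)
    (z : CosphereBundle gM) : CosphereBundle gN :=
  ⟨cotangentLift p z.1, by rw [conorm_cotangentLift hp, hg]; exact z.2⟩

/-! ### Liouville measure -/

instance [IsManifold (𝓡 n) ∞ M] : MeasurableSpace (CotangentBundle n M) := borel _

instance [IsManifold (𝓡 n) ∞ M] : BorelSpace (CotangentBundle n M) := ⟨rfl⟩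

instance [IsManifold (𝓡 n) ∞ M] (g : FormField n M) : MeasurableSpace (CosphereBundle g) :=
  inferInstanceAs (MeasurableSpace {z : CotangentBundle n M // conorm g z.1 z.2 = 1})

/-- The inverse of the canonical chart of `T^*M` induced by a chart `e = (x^1, …, x^n)` of `M`:
it sends `(y, η)` to the covector `∑ i, η_i dx^i` at the point with coordinates `y`. -/
def canonicalCoord (e : OpenPartialHomeomorph M (EuclideanSpace ℝ (Fin n)))
    (q : EuclideanSpace ℝ (Fin n) × EuclideanSpace ℝ (Fin n)) : CotangentBundle n M :=
  ⟨e.symm q.1, (innerSL ℝ q.2 : EuclideanSpace ℝ (Fin n) →L[ℝ] ℝ) ∘L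
    (mfderiv (𝓡 n) (𝓡 n) e (e.symm q.1) : TangentSpace (𝓡 n) (e.symm q.1) →L[ℝ] _)⟩

/-- The symplectic volume `|ω^n / n!|` on `T^*M`: in the canonical coordinates of every smooth
chart it is Lebesgue measure `dx dξ`. These local measures agree on overlaps, and their supremum
glues them. -/
def symplecticVolume (n : ℕ) (M : Type*) [TopologicalSpace M]
    [ChartedSpace (EuclideanSpace ℝ (Fin n)) M] [IsManifold (𝓡 n) ∞ M] :
    Measure (CotangentBundle n M) :=
  ⨆ e ∈ IsManifold.maximalAtlas (𝓡 n) ∞ M,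
    ((volume : Measure (EuclideanSpace ℝ (Fin n) × EuclideanSpace ℝ (Fin n))).restrict
      (e.target ×ˢ Set.univ)).map (canonicalCoord e)

/-- The radial projection `(x, ξ) ↦ (x, ξ / |ξ|_g)` from the punctured open unit codisc bundle to
the unit cosphere bundle. -/
def radialProj (g : FormField n M)
    (z : {z : CotangentBundle n M // 0 < conorm g z.1 z.2 ∧ conorm g z.1 z.2 < 1}) :
    CosphereBundle g :=
  ⟨⟨z.1.1, (conorm g z.1.1 z.1.2)⁻¹ • z.1.2⟩, by
    have h := z.2.1
    rw [conorm_smul g _ (inv_nonneg.2 h.le), inv_mul_cancel₀ h.ne']⟩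

/-- The Liouville measure on `S^*_g M`, that is the quotient of the symplectic volume by `dH`,
`H = |ξ|_g^2 / 2`, on the level set `|ξ|_g = 1`; equivalently `dσ_x(ξ) dvol_g(x)` with the surface
measures `σ_x` of the unit cospheres. As the symplectic volume is `r^{n-1} dr dμ_L` in polar
coordinates, the measure of a set `B` is `n` times the symplectic volume of
`{(x, r ξ) : (x, ξ) ∈ B, 0 < r < 1}`. -/
def liouvilleMeasure [IsManifold (𝓡 n) ∞ M] (g : FormField n M) : Measure (CosphereBundle g) :=
  (n : ℝ≥0∞) • ((symplecticVolume n M).comap Subtype.val).map (radialProj g)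

/-- The Liouville measure scaled to total mass one. -/
def normalizedLiouvilleMeasure [IsManifold (𝓡 n) ∞ M] (g : FormField n M) : Measure (CosphereBundle g) :=
  (liouvilleMeasure g Set.univ)⁻¹ • liouvilleMeasure g

end Manifold

/-! ### Quasi-regular representations and their intertwining kernels -/

section Rep

variable {G : Type*} [Group G]

/-- The action of `G` on `L^2(G/H)` (counting measure), `(a f)(xH) = f(a⁻¹xH)`. -/
def quasiRegular (H : Subgroup G) (a : G) (f : EuclideanSpace ℂ (G ⧸ H)) :
    EuclideanSpace ℂ (G ⧸ H) :=
  WithLp.toLp 2 fun x => f (a⁻¹ • x)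

/-- A unitary `G`-map `L^2(G/H₁) → L^2(G/H₂)`. -/
structure UnitaryIntertwiner (H₁ H₂ : Subgroup G) [Fintype (G ⧸ H₁)] [Fintype (G ⧸ H₂)] where
  toEquiv : EuclideanSpace ℂ (G ⧸ H₁) ≃ₗᵢ[ℂ] EuclideanSpace ℂ (G ⧸ H₂)
  map_quasiRegular : ∀ (a : G) (f : EuclideanSpace ℂ (G ⧸ H₁)),
    toEquiv (quasiRegular H₁ a f) = quasiRegular H₂ a (toEquiv f)

/-- `A`, a function on `H₂\G/H₁`, is the convolution kernel of `T : L^2(G/H₁) → L^2(G/H₂)`: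
`(T f)(xH₂) = ∑_{y ∈ G} A(x⁻¹y) f(yH₁)`. -/
def IsConvolutionKernel [Fintype G] {H₁ H₂ : Subgroup G} [Fintype (G ⧸ H₁)] [Fintype (G ⧸ H₂)]
    (T : UnitaryIntertwiner H₁ H₂)
    (A : DoubleCoset.Quotient (H₂ : Set G) (H₁ : Set G) → ℂ) : Prop :=
  ∀ (f : EuclideanSpace ℂ (G ⧸ H₁)) (x : G),
    T.toEquiv f (x : G ⧸ H₂) = ∑ y : G, A (DoubleCoset.mk H₂ H₁ (x⁻¹ * y)) * f (y : G ⧸ H₁)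

end Rep

/-! ### The diagram of covers and the lifted Radon transform -/

/-- A diagram of smooth finite covers `M → M_i = H_i\M → M_0 = G\M`, `i = 1, 2`, for a free action
of `G` on `M` by deck transformations. (A cover by `K\M` is a quotient covering map for the action
of `K`; it follows that the `sub_i` are covering maps.) -/
structure CoverDiagram (n : ℕ) {G : Type*} [Group G] (H₁ H₂ : Subgroup G)
    (M M₁ M₂ M₀ : Type*)
    [TopologicalSpace M] [ChartedSpace (EuclideanSpace ℝ (Fin n)) M] [MulAction G M]
    [TopologicalSpace M₁] [ChartedSpace (EuclideanSpace ℝ (Fin n)) M₁]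
    [TopologicalSpace M₂] [ChartedSpace (EuclideanSpace ℝ (Fin n)) M₂]
    [TopologicalSpace M₀] [ChartedSpace (EuclideanSpace ℝ (Fin n)) M₀] where
  proj : M → M₀
  proj₁ : M → M₁
  proj₂ : M → M₂
  sub₁ : M₁ → M₀
  sub₂ : M₂ → M₀
  smooth_smul : ∀ a : G, ContMDiff (𝓡 n) (𝓡 n) ∞ (fun x : M => a • x)
  cover : IsQuotientCoveringMap proj G
  cover₁ : IsQuotientCoveringMap proj₁ H₁
  cover₂ : IsQuotientCoveringMap proj₂ H₂
  proj_diffeo : IsLocalDiffeomorph (𝓡 n) (𝓡 n) ∞ proj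
  proj₁_diffeo : IsLocalDiffeomorph (𝓡 n) (𝓡 n) ∞ proj₁
  proj₂_diffeo : IsLocalDiffeomorph (𝓡 n) (𝓡 n) ∞ proj₂
  sub₁_diffeo : IsLocalDiffeomorph (𝓡 n) (𝓡 n) ∞ sub₁
  sub₂_diffeo : IsLocalDiffeomorph (𝓡 n) (𝓡 n) ∞ sub₂
  comm₁ : sub₁ ∘ proj₁ = proj
  comm₂ : sub₂ ∘ proj₂ = proj

namespace CoverDiagram

variable {n : ℕ} {G : Type*} [Group G] {H₁ H₂ : Subgroup G} {M M₁ M₂ M₀ : Type*}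
  [TopologicalSpace M] [ChartedSpace (EuclideanSpace ℝ (Fin n)) M] [MulAction G M]
  [TopologicalSpace M₁] [ChartedSpace (EuclideanSpace ℝ (Fin n)) M₁]
  [TopologicalSpace M₂] [ChartedSpace (EuclideanSpace ℝ (Fin n)) M₂]
  [TopologicalSpace M₀] [ChartedSpace (EuclideanSpace ℝ (Fin n)) M₀]

lemma smul_diffeo (D : CoverDiagram n H₁ H₂ M M₁ M₂ M₀) (a : G) :
    IsLocalDiffeomorph (𝓡 n) (𝓡 n) ∞ (fun x : M => a • x) :=
  Diffeomorph.isLocalDiffeomorph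
    { toFun := fun x : M => a • x
      invFun := fun x : M => a⁻¹ • x
      left_inv := fun x => inv_smul_smul a x
      right_inv := fun x => smul_inv_smul a x
      contMDiff_toFun := D.smooth_smul a
      contMDiff_invFun := D.smooth_smul a⁻¹ }

lemma proj_smul (D : CoverDiagram n H₁ H₂ M M₁ M₂ M₀) (a : G) :
    D.proj ∘ (fun x : M => a • x) = D.proj :=
  funext fun _ => D.cover.map_smul a

variable (D : CoverDiagram n H₁ H₂ M M₁ M₂ M₀) (g₀ : FormField n M₀)

/-- The metric `g = π^*g₀` on `M`. -/
def metric : FormField n M := pullbackForm D.proj g₀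

/-- The metric `g₁ = p₁^*g₀` on `M₁`. -/
def metric₁ : FormField n M₁ := pullbackForm D.sub₁ g₀

/-- The metric `g₂ = p₂^*g₀` on `M₂`. -/
def metric₂ : FormField n M₂ := pullbackForm D.sub₂ g₀

/-- The lifted cover `S^*M → S^*M₁`. -/
def lift₁ : CosphereBundle (D.metric g₀) → CosphereBundle (D.metric₁ g₀) :=
  cosphereLift D.proj₁ D.proj₁_diffeo
    (pullbackForm_comp D.comm₁ D.sub₁_diffeo D.proj₁_diffeo g₀)

/-- The lifted cover `S^*M → S^*M₂`. -/
def lift₂ : CosphereBundle (D.metric g₀) → CosphereBundle (D.metric₂ g₀) :=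
  cosphereLift D.proj₂ D.proj₂_diffeo
    (pullbackForm_comp D.comm₂ D.sub₂_diffeo D.proj₂_diffeo g₀)

/-- The lifted deck transformation of `S^*M`, `(x, ξ) ↦ (a x, (a⁻¹)^* ξ)`. -/
def liftDeck (a : G) : CosphereBundle (D.metric g₀) → CosphereBundle (D.metric g₀) :=
  cosphereLift (fun x : M => a • x) (D.smul_diffeo a)
    (pullbackForm_comp (D.proj_smul a) D.proj_diffeo (D.smul_diffeo a) g₀)

/-- Pullback of functions from `S^*M₁` to `S^*M`. -/
def pullback₁ (F : CosphereBundle (D.metric₁ g₀) → ℂ) : CosphereBundle (D.metric g₀) → ℂ :=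
  F ∘ D.lift₁ g₀

/-- Translation of functions on `S^*M` by `a`; it is multiplicative in `a`. -/
def translate (a : G) (f : CosphereBundle (D.metric g₀) → ℂ) : CosphereBundle (D.metric g₀) → ℂ :=
  f ∘ D.liftDeck g₀ a⁻¹

/-- Pushforward of functions from `S^*M` to `S^*M₂`: the sum over the (finite) fibre. -/
def pushforward₂ (f : CosphereBundle (D.metric g₀) → ℂ) : CosphereBundle (D.metric₂ g₀) → ℂ :=
  fun η => ∑ᶠ (ζ : CosphereBundle (D.metric g₀)) (_ : D.lift₂ g₀ ζ = η), f ζ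

/-- The lifted finite Radon transform `(1/#H₁) ∑_{a ∈ G} A(a) π̃₂_* T̃_a π̃₁^*` on functions. -/
def radon [Fintype G] (A : DoubleCoset.Quotient (H₂ : Set G) (H₁ : Set G) → ℂ)
    (F : CosphereBundle (D.metric₁ g₀) → ℂ) : CosphereBundle (D.metric₂ g₀) → ℂ :=
  fun η => (Nat.card H₁ : ℂ)⁻¹ *
    ∑ a : G, A (DoubleCoset.mk H₂ H₁ a) *
      D.pushforward₂ g₀ (D.translate g₀ a (D.pullback₁ g₀ F)) η

end CoverDiagram

/-- The operator `U` on functions is (well defined on classes and) a unitary operator from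
`L^2(μ)` onto `L^2(ν)`. -/
def IsUnitaryOnL2 {X Y : Type*} [MeasurableSpace X] [MeasurableSpace Y] (μ : Measure X)
    (ν : Measure Y) (U : (X → ℂ) → (Y → ℂ)) : Prop :=
  ∃ W : Lp ℂ 2 μ ≃ₗᵢ[ℂ] Lp ℂ 2 ν,
    ∀ (F : X → ℂ) (hF : MemLp F 2 μ), W (hF.toLp F) =ᵐ[ν] U F

end FiniteRadon

end

/-!
The unitary operator `𝒜` is a `G`-map, hence a convolution operator, and its kernel `A` is
determined by the image of the delta function at the base coset
(`existsUnique_isConvolutionKernel`).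

The transform `Ũ_A` is `𝒜` applied along the `G`-orbits of `S^*M`. For a function `F` on `S^*M₁`
and `x ∈ S^*M` let `φ_x(yH₁) = F(π̃₁(y⁻¹x))`, a function on `G/H₁`. As `#H₁ = #H₂`, because
`L²(G/H₁)` and `L²(G/H₂)` have the same dimension, `Ũ_A F` has the values
`(Ũ_A F)(π̃₂ x) = ∑ a, A(a) F(π̃₁(a⁻¹x))` (`CoverDiagram.radon_eq_kernelOp`), and the convolution
formula says that `(𝒜 φ_x)(wH₂) = (Ũ_A F)(π̃₂(w⁻¹x))` (`IsMeasuredQuotient.orbitFun_kernelOp`).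
So the sum of `|F|²` over the translates `y⁻¹x`, `yH₁ ∈ G/H₁`, equals that of `|Ũ_A F|²` over
`w⁻¹x`, `wH₂ ∈ G/H₂`; integrating over `S^*M` gives that `Ũ_A` is isometric
(`IsMeasuredQuotient.lintegral_kernelOp`), and the kernel of `𝒜⁻¹` gives its inverse.

The integration uses that the Liouville measure of `S^*M` is invariant under the lifted deck
transformations and that `π̃_i` maps it to `#H_i` times the Liouville measure of `S^*M_i`. Both are
cases of `map_cosphereLift_liouvilleMeasure`, for a quotient covering by a finite group, which is
trivial in the case of a deck transformation. It rests on the invariance of the symplectic volume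
under cotangent lifts of local diffeomorphisms: in canonical coordinates such a lift is
`(y, η) ↦ (φ y, (dφ_y⁻¹)ᵀ η)`, whose Jacobians on base and fibre cancel (`map_flatLift_volume`).
With the identity of `M` in place of the local diffeomorphism this shows that the chart measures
agree on overlaps, so that over a chart domain their supremum is the measure of that chart
(`symplecticVolume_restrict_source`). Well-definedness on classes and measurability of `Ũ_A F` come
from the fact that the lifted coverings map Borel sets to Borel sets.
-/

noncomputable section

namespace FiniteRadon

open Filter Topology Bundle Set

/-! ### The topology of the cotangent bundle -/

section Topology

variable {n : ℕ} {M : Type*} [TopologicalSpace M] [ChartedSpace (EuclideanSpace ℝ (Fin n)) M]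
  [IsManifold (𝓡 n) ∞ M]
  {N : Type*} [TopologicalSpace N] [ChartedSpace (EuclideanSpace ℝ (Fin n)) N]
  [IsManifold (𝓡 n) ∞ N]
  {P : Type*} [TopologicalSpace P] [ChartedSpace (EuclideanSpace ℝ (Fin n)) P]
  {X : Type*} [TopologicalSpace X]

/-- The local section of `TM` near `x₀` that is constant, equal to `v`, in the preferred
trivialization. -/
def localSection (x₀ : M) (v : EuclideanSpace ℝ (Fin n)) (x : M) : TangentSpace (𝓡 n) x :=
  (trivializationAt (EuclideanSpace ℝ (Fin n)) (TangentSpace (𝓡 n) : M → Type _) x₀).symmL ℝ x v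

lemma continuousAt_localSection (x₀ : M) (v : EuclideanSpace ℝ (Fin n)) :
    ContinuousAt (fun x : M => (⟨x, localSection x₀ v x⟩ : TangentBundle (𝓡 n) M)) x₀ := by
  set t := trivializationAt (EuclideanSpace ℝ (Fin n)) (TangentSpace (𝓡 n) : M → Type _) x₀
  have hx : x₀ ∈ t.baseSet := mem_baseSet_trivializationAt _ _ _
  have h : ContinuousAt (fun x : M => t.toOpenPartialHomeomorph.symm (x, v)) x₀ := by
    refine ContinuousAt.comp (f := fun x : M => (x, v))
      (t.continuousOn_invFun.continuousAt ?_) (by fun_prop)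
    exact t.open_target.mem_nhds (by simp [t.mem_target, hx])
  refine h.congr ?_
  filter_upwards [t.open_baseSet.mem_nhds hx] with x hx'
  rw [localSection, t.symmL_apply hx', t.mk_symm hx']

/-- A covector field along a map is continuous if its values on the local sections are. -/
lemma continuousAt_cotangent {z : X → CotangentBundle n M} {x₀ : X}
    (hb : ContinuousAt (fun x => (z x).1) x₀)
    (h : ∀ v, ContinuousAt (fun x => (z x).2 (localSection (z x₀).1 v (z x).1)) x₀) :
    ContinuousAt z x₀ := by
  rw [continuousAt_hom_bundle]
  refine ⟨hb, ?_⟩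
  rw [continuousAt_clm_apply]
  intro v
  refine (h v).congr (.of_forall fun x => ?_)
  simp [ContinuousLinearMap.inCoordinates, localSection]

lemma continuousAt_pairing {b : X → M} {ξ : ∀ x, CotangentSpace n (b x)}
    {v : ∀ x, TangentSpace (𝓡 n) (b x)} {x₀ : X}
    (hξ : ContinuousAt (fun x => (⟨b x, ξ x⟩ : CotangentBundle n M)) x₀)
    (hv : ContinuousAt (fun x => (⟨b x, v x⟩ : TangentBundle (𝓡 n) M)) x₀) :
    ContinuousAt (fun x => (ξ x (v x) : ℝ)) x₀ := by
  have := ContinuousAt.clm_bundle_apply (F₁ := EuclideanSpace ℝ (Fin n)) (F₂ := ℝ)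
    (E₁ := (TangentSpace (𝓡 n) : M → Type _)) (E₂ := Bundle.Trivial M ℝ) hξ hv
  rw [FiberBundle.continuousAt_totalSpace] at this
  exact this.2

lemma continuous_cotangentBundle_proj :
    Continuous (fun z : CotangentBundle n M => z.1) :=
  FiberBundle.continuous_proj _ _

lemma continuous_smul_cotangent :
    Continuous (fun q : ℝ × CotangentBundle n M =>
      (⟨q.2.1, q.1 • q.2.2⟩ : CotangentBundle n M)) := by
  rw [continuous_iff_continuousAt]
  intro q₀
  have hb : Continuous (fun q : ℝ × CotangentBundle n M => q.2.1) :=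
    continuous_cotangentBundle_proj.comp continuous_snd
  refine continuousAt_cotangent hb.continuousAt fun v => ?_
  have h := continuousAt_pairing (b := fun q : ℝ × CotangentBundle n M => q.2.1)
    (ξ := fun q => q.2.2) (v := fun q => localSection q₀.2.1 v q.2.1) (x₀ := q₀)
    continuous_snd.continuousAt
    (ContinuousAt.comp (f := fun q : ℝ × CotangentBundle n M => q.2.1)
      (continuousAt_localSection q₀.2.1 v) hb.continuousAt)
  exact continuousAt_fst.mul h

end Topology

/-! ### Cotangent lifts of local diffeomorphisms -/

section Lift

variable {n : ℕ} {M : Type*} [TopologicalSpace M] [ChartedSpace (EuclideanSpace ℝ (Fin n)) M]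
  {N : Type*} [TopologicalSpace N] [ChartedSpace (EuclideanSpace ℝ (Fin n)) N]
  {P : Type*} [TopologicalSpace P] [ChartedSpace (EuclideanSpace ℝ (Fin n)) P]

lemma cotangentLift_id (z : CotangentBundle n M) : cotangentLift (id : M → M) z = z := by
  have : (mfderiv (𝓡 n) (𝓡 n) (id : M → M) z.1).inverse = ContinuousLinearMap.id ℝ _ := by
    rw [mfderiv_id]; exact ContinuousLinearMap.inverse_id
  unfold cotangentLift
  rw [this]
  rfl

lemma cotangentLift_congr {p q : M → N} {z : CotangentBundle n M} (h : p =ᶠ[𝓝 z.1] q) :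
    cotangentLift p z = cotangentLift q z := by
  have h1 := h.eq_of_nhds
  have h2 : (mfderiv (𝓡 n) (𝓡 n) p z.1 : EuclideanSpace ℝ (Fin n) →L[ℝ] EuclideanSpace ℝ (Fin n))
    = mfderiv (𝓡 n) (𝓡 n) q z.1 := h.mfderiv_eq
  unfold cotangentLift
  rw [TotalSpace.mk.injEq]
  refine ⟨h1, heq_of_eq ?_⟩
  exact congrArg (fun L : EuclideanSpace ℝ (Fin n) →L[ℝ] EuclideanSpace ℝ (Fin n) =>
    (z.2 : EuclideanSpace ℝ (Fin n) →L[ℝ] ℝ) ∘L L.inverse) h2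

lemma cotangentLift_comp {p : N → P} {q : M → N} {z : CotangentBundle n M}
    (hp : IsLocalDiffeomorphAt (𝓡 n) (𝓡 n) ∞ p (q z.1))
    (hq : IsLocalDiffeomorphAt (𝓡 n) (𝓡 n) ∞ q z.1) :
    cotangentLift (p ∘ q) z = cotangentLift p (cotangentLift q z) := by
  have h := mfderiv_comp z.1 (hp.mdifferentiableAt (by simp)) (hq.mdifferentiableAt (by simp))
  have hpi : (mfderiv (𝓡 n) (𝓡 n) p (q z.1)).IsInvertible :=
    ⟨hp.mfderivToContinuousLinearEquiv (by simp), rfl⟩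
  unfold cotangentLift
  simp only
  rw [h, ContinuousLinearMap.IsInvertible.inverse_comp_of_left hpi]
  rfl

lemma inverse_eq_of_comp_eq_id {E F : Type*} [NormedAddCommGroup E] [NormedSpace ℝ E]
    [NormedAddCommGroup F] [NormedSpace ℝ F] {A : E →L[ℝ] F} {B : F →L[ℝ] E}
    (hA : A.IsInvertible) (h : B ∘L A = ContinuousLinearMap.id ℝ E) : A.inverse = B := by
  ext1 w
  obtain ⟨v, rfl⟩ := hA.bijective.2 w
  rw [hA.inverse_apply_eq.2 rfl]
  exact (congrArg (fun L => L v) h).symm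

/-- The differentials of a partial diffeomorphism and of its inverse are inverse to each other, as
endomorphisms of the model space `ℝⁿ`, to which all tangent spaces are definitionally equal. -/
lemma inverse_mfderiv_partialDiffeomorph (Φ : PartialDiffeomorph (𝓡 n) (𝓡 n) M N ∞) {x : M}
    (hx : x ∈ Φ.source) :
    ((mfderiv (𝓡 n) (𝓡 n) Φ x).inverse : EuclideanSpace ℝ (Fin n) →L[ℝ] EuclideanSpace ℝ (Fin n))
      = mfderiv (𝓡 n) (𝓡 n) Φ.symm (Φ x) := by
  have hd := Φ.mdifferentiableAt (by simp) hx
  have hy : Φ x ∈ Φ.symm.source := Φ.map_source hx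
  have hd' := Φ.symm.mdifferentiableAt (by simp) hy
  have hl : Φ.symm ∘ Φ =ᶠ[𝓝 x] id := by
    filter_upwards [Φ.open_source.mem_nhds hx] with y hy using Φ.left_inv hy
  have h1 := mfderiv_comp x hd' hd
  rw [hl.mfderiv_eq, mfderiv_id] at h1
  have hi : (mfderiv (𝓡 n) (𝓡 n) Φ x).IsInvertible :=
    ⟨(Φ.isLocalDiffeomorphAt _ _ _ hx).mfderivToContinuousLinearEquiv (by simp), rfl⟩
  exact inverse_eq_of_comp_eq_id (E := EuclideanSpace ℝ (Fin n)) (F := EuclideanSpace ℝ (Fin n))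
    (A := mfderiv (𝓡 n) (𝓡 n) Φ x) (B := mfderiv (𝓡 n) (𝓡 n) Φ.symm (Φ x)) hi h1.symm

variable [IsManifold (𝓡 n) ∞ M] [IsManifold (𝓡 n) ∞ N]

lemma continuousAt_cotangentLift {p : M → N} {z₀ : CotangentBundle n M}
    (hp : IsLocalDiffeomorphAt (𝓡 n) (𝓡 n) ∞ p z₀.1) : ContinuousAt (cotangentLift p) z₀ := by
  have hb : ContinuousAt (fun z : CotangentBundle n M => p z.1) z₀ :=
    ContinuousAt.comp (f := fun z : CotangentBundle n M => z.1) hp.contMDiffAt.continuousAt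
      continuous_cotangentBundle_proj.continuousAt
  obtain ⟨Φ, hx, he⟩ := hp
  refine continuousAt_cotangent hb fun v => ?_
  set y₀ : N := p z₀.1
  have hy₀ : y₀ ∈ Φ.symm.source := by
    show p z₀.1 ∈ _
    rw [he hx]
    exact Φ.map_source hx
  have hs : ContMDiffAt (𝓡 n) (𝓡 n) ∞ Φ.symm y₀ :=
    Φ.symm.contMDiffOn.contMDiffAt (Φ.symm.open_source.mem_nhds hy₀)
  -- the section of `TM` obtained by pulling back the local section of `TN`
  have h1 : ContinuousAt (fun y : N => (⟨Φ.symm y, mfderiv (𝓡 n) (𝓡 n) Φ.symm y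
      (localSection y₀ v y)⟩ : TangentBundle (𝓡 n) M)) y₀ :=
    ContinuousAt.clm_apply_of_inCoordinates (b₁ := fun y : N => y) (b₂ := fun y => Φ.symm y)
      (ϕ := fun y => mfderiv (𝓡 n) (𝓡 n) Φ.symm y)
      (hs.mfderiv_const (m := 0) (by simp)).continuousAt
      (continuousAt_localSection y₀ v) hs.continuousAt
  have h2 := ContinuousAt.comp (f := fun z : CotangentBundle n M => p z.1) (x := z₀) h1 hb
  have hU : ∀ᶠ z : CotangentBundle n M in 𝓝 z₀, z.1 ∈ Φ.source :=
    continuous_cotangentBundle_proj.continuousAt (Φ.open_source.mem_nhds hx)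
  have h3 : ContinuousAt (fun z : CotangentBundle n M => (⟨z.1,
      (mfderiv (𝓡 n) (𝓡 n) p z.1).inverse (localSection y₀ v (p z.1))⟩ : TangentBundle (𝓡 n) M))
      z₀ := by
    refine h2.congr ?_
    filter_upwards [hU] with z hz
    have hd : (mfderiv (𝓡 n) (𝓡 n) p z.1 :
        EuclideanSpace ℝ (Fin n) →L[ℝ] EuclideanSpace ℝ (Fin n)) = mfderiv (𝓡 n) (𝓡 n) Φ z.1 :=
      (he.eventuallyEq_of_mem (Φ.open_source.mem_nhds hz)).mfderiv_eq
    have hi := inverse_mfderiv_partialDiffeomorph Φ hz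
    simp only [Function.comp_apply, TotalSpace.mk.injEq]
    refine ⟨by rw [he hz]; exact Φ.left_inv hz, heq_of_eq ?_⟩
    have h4 := congrArg (fun L : EuclideanSpace ℝ (Fin n) →L[ℝ] EuclideanSpace ℝ (Fin n) =>
      L.inverse) hd
    have h5 : (mfderiv (𝓡 n) (𝓡 n) Φ.symm (p z.1) :
        EuclideanSpace ℝ (Fin n) →L[ℝ] EuclideanSpace ℝ (Fin n))
        = mfderiv (𝓡 n) (𝓡 n) Φ.symm (Φ z.1) := by rw [he hz]
    exact congrArg (fun L : EuclideanSpace ℝ (Fin n) →L[ℝ] EuclideanSpace ℝ (Fin n) =>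
      L (localSection y₀ v (p z.1))) (h5.trans (hi.symm.trans h4.symm))
  exact continuousAt_pairing (ξ := fun z : CotangentBundle n M => z.2) continuousAt_id h3

lemma continuous_cotangentLift {p : M → N} (hp : IsLocalDiffeomorph (𝓡 n) (𝓡 n) ∞ p) :
    Continuous (cotangentLift p : CotangentBundle n M → CotangentBundle n N) :=
  continuous_iff_continuousAt.2 fun z => continuousAt_cotangentLift (hp z.1)

/-- The lift of the local inverse of `p` is a local inverse of the lift of `p`. -/
lemma isOpenMap_cotangentLift {p : M → N} (hp : IsLocalDiffeomorph (𝓡 n) (𝓡 n) ∞ p) :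
    IsOpenMap (cotangentLift p : CotangentBundle n M → CotangentBundle n N) := by
  refine IsOpenMap.of_nhds_le fun z => ?_
  obtain ⟨Φ, hx, he⟩ := hp z.1
  have hy : p z.1 ∈ Φ.symm.source := by rw [he hx]; exact Φ.map_source hx
  have hs : ∀ y ∈ Φ.symm.source, IsLocalDiffeomorphAt (𝓡 n) (𝓡 n) ∞ (Φ.symm : N → M) y :=
    fun y hy => Φ.symm.isLocalDiffeomorphAt _ _ _ hy
  have hc : ContinuousAt (cotangentLift (Φ.symm : N → M)) (cotangentLift p z) :=
    continuousAt_cotangentLift (hs _ hy)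
  have hz : cotangentLift (Φ.symm : N → M) (cotangentLift p z) = z := by
    rw [← cotangentLift_comp (hs _ hy) (hp z.1)]
    refine (cotangentLift_congr ?_).trans (cotangentLift_id z)
    filter_upwards [Φ.open_source.mem_nhds hx] with x hx
    rw [Function.comp_apply, he hx]
    exact Φ.left_inv hx
  have hr : cotangentLift p ∘ cotangentLift (Φ.symm : N → M) =ᶠ[𝓝 (cotangentLift p z)] id := by
    have : ∀ᶠ w : CotangentBundle n N in 𝓝 (cotangentLift p z), w.1 ∈ Φ.symm.source :=
      continuous_cotangentBundle_proj.continuousAt (Φ.symm.open_source.mem_nhds hy)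
    filter_upwards [this] with w hw
    rw [Function.comp_apply, ← cotangentLift_comp (hp _) (hs _ hw)]
    refine (cotangentLift_congr ?_).trans (cotangentLift_id w)
    filter_upwards [Φ.symm.open_source.mem_nhds hw] with y hy
    simp only [Function.comp_apply, id]
    rw [he (Φ.symm.map_source hy)]
    exact Φ.right_inv hy
  calc 𝓝 (cotangentLift p z)
      = map (cotangentLift p ∘ cotangentLift (Φ.symm : N → M)) (𝓝 (cotangentLift p z)) := by
        rw [map_congr hr, map_id]
    _ = map (cotangentLift p) (map (cotangentLift (Φ.symm : N → M)) (𝓝 (cotangentLift p z))) := by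
        rw [map_map]
    _ ≤ map (cotangentLift p) (𝓝 z) := by
        refine map_mono ?_
        have := hc.tendsto
        rwa [hz] at this

omit [IsManifold (𝓡 n) ∞ M] [IsManifold (𝓡 n) ∞ N] in
lemma cotangentLift_injOn {p : M → N} (hp : IsLocalDiffeomorph (𝓡 n) (𝓡 n) ∞ p) {U : Set M}
    (hU : InjOn p U) : InjOn (cotangentLift p) {z : CotangentBundle n M | z.1 ∈ U} := by
  rintro ⟨x, ξ⟩ hx ⟨y, ζ⟩ hy h
  obtain rfl : x = y := hU hx hy (congrArg TotalSpace.proj h)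
  have hi : (mfderiv (𝓡 n) (𝓡 n) p x).IsInvertible :=
    ⟨(hp x).mfderivToContinuousLinearEquiv (by simp), rfl⟩
  have h' := eq_of_heq (TotalSpace.mk.inj h).2
  congr 1
  ext1 v
  have h2 := congrArg (fun L => L (mfderiv (𝓡 n) (𝓡 n) p x v)) h'
  have h3 : (mfderiv (𝓡 n) (𝓡 n) p x).inverse (mfderiv (𝓡 n) (𝓡 n) p x v) = v :=
    hi.inverse_apply_eq.2 rfl
  simp only [ContinuousLinearMap.comp_apply] at h2
  rw [h3] at h2
  exact h2

omit [IsManifold (𝓡 n) ∞ M] [IsManifold (𝓡 n) ∞ N] in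
lemma cotangentLift_surjective {p : M → N} (hp : IsLocalDiffeomorph (𝓡 n) (𝓡 n) ∞ p)
    (hs : Function.Surjective p) :
    Function.Surjective (cotangentLift p : CotangentBundle n M → CotangentBundle n N) := by
  rintro ⟨y, ζ⟩
  obtain ⟨x, rfl⟩ := hs y
  have hi : (mfderiv (𝓡 n) (𝓡 n) p x).IsInvertible :=
    ⟨(hp x).mfderivToContinuousLinearEquiv (by simp), rfl⟩
  refine ⟨⟨x, ζ ∘L mfderiv (𝓡 n) (𝓡 n) p x⟩, ?_⟩
  unfold cotangentLift
  simp only [TotalSpace.mk.injEq, heq_eq_eq, true_and]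
  ext1 v
  have h3 : mfderiv (𝓡 n) (𝓡 n) p x ((mfderiv (𝓡 n) (𝓡 n) p x).inverse v) = v :=
    (hi.inverse_apply_eq.1 rfl).symm
  simp only [ContinuousLinearMap.comp_apply]
  rw [h3]

omit [IsManifold (𝓡 n) ∞ M] [IsManifold (𝓡 n) ∞ N] in
lemma exists_isOpen_injOn {p : M → N}
    (hp : IsLocalDiffeomorph (𝓡 n) (𝓡 n) ∞ p) (x : M) :
    ∃ U : Set M, IsOpen U ∧ x ∈ U ∧ InjOn p U := by
  obtain ⟨Φ, hx, he⟩ := hp x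
  exact ⟨Φ.source, Φ.open_source, hx, (he.injOn_iff).2 Φ.injOn⟩

/-- The lift of a local diffeomorphism maps Borel sets to Borel sets, because it is an open
embedding over the members of a countable open cover. -/
lemma measurableSet_image_cotangentLift [SecondCountableTopology M] {p : M → N}
    (hp : IsLocalDiffeomorph (𝓡 n) (𝓡 n) ∞ p) {C : Set (CotangentBundle n M)}
    (hC : MeasurableSet C) : MeasurableSet (cotangentLift p '' C) := by
  choose U hUo hxU hU using exists_isOpen_injOn hp
  obtain ⟨s, hs, hcov⟩ := TopologicalSpace.countable_cover_nhds fun x => (hUo x).mem_nhds (hxU x)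
  have hC' : C = ⋃ x ∈ s, C ∩ {z : CotangentBundle n M | z.1 ∈ U x} := by
    ext z
    have : z.1 ∈ ⋃ x ∈ s, U x := hcov ▸ mem_univ _
    simp only [mem_iUnion, exists_prop] at this ⊢
    obtain ⟨x, hx, hz⟩ := this
    exact ⟨fun h => ⟨x, hx, h, hz⟩, fun ⟨_, _, h, _⟩ => h⟩
  rw [hC', image_iUnion₂]
  refine MeasurableSet.biUnion hs fun x _ => ?_
  have hV : IsOpen {z : CotangentBundle n M | z.1 ∈ U x} :=
    (hUo x).preimage continuous_cotangentBundle_proj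
  have hemb : Topology.IsOpenEmbedding
      ({z : CotangentBundle n M | z.1 ∈ U x}.domRestrict
        (cotangentLift p : CotangentBundle n M → CotangentBundle n N)) :=
    .of_continuous_injective_isOpenMap ((continuous_cotangentLift hp).comp continuous_subtype_val)
      (injOn_iff_injective.1 (cotangentLift_injOn hp (hU x)))
      ((isOpenMap_cotangentLift hp).domRestrict hV)
  have := hemb.measurableEmbedding.measurableSet_image' (measurable_subtype_coe hC)
  rwa [domRestrict_eq, image_comp, Subtype.image_preimage_coe, inter_comm] at this

end Lift

/-! ### Canonical coordinates -/

section CanonicalCoord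

variable {n : ℕ} {M : Type*} [TopologicalSpace M] [ChartedSpace (EuclideanSpace ℝ (Fin n)) M]
  [IsManifold (𝓡 n) ∞ M]

/-- The identification `(y, η) ↦ ∑ i, η_i dy^i` of `ℝⁿ × ℝⁿ` with `T^*ℝⁿ`. -/
def flatCovector (q : EuclideanSpace ℝ (Fin n) × EuclideanSpace ℝ (Fin n)) :
    CotangentBundle n (EuclideanSpace ℝ (Fin n)) :=
  ⟨q.1, (innerSL ℝ q.2 : EuclideanSpace ℝ (Fin n) →L[ℝ] ℝ)⟩

lemma continuous_flatCovector : Continuous (flatCovector (n := n)) := by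
  refine continuous_iff_continuousAt.2 fun q₀ => continuousAt_cotangent continuousAt_fst fun v => ?_
  have : (fun q : EuclideanSpace ℝ (Fin n) × EuclideanSpace ℝ (Fin n) =>
      (flatCovector q).2 (localSection (flatCovector q₀).1 v (flatCovector q).1))
      = fun q => inner ℝ q.2 v := by
    funext q
    simp [flatCovector, localSection]
    rfl
  rw [this]
  fun_prop

/-- A smooth chart as a partial diffeomorphism. -/
def chartDiffeo {e : OpenPartialHomeomorph M (EuclideanSpace ℝ (Fin n))}
    (he : e ∈ IsManifold.maximalAtlas (𝓡 n) ∞ M) :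
    PartialDiffeomorph (𝓡 n) (𝓡 n) M (EuclideanSpace ℝ (Fin n)) ∞ where
  toPartialEquiv := e.toPartialEquiv
  open_source := e.open_source
  open_target := e.open_target
  contMDiffOn_toFun := contMDiffOn_of_mem_maximalAtlas he
  contMDiffOn_invFun := contMDiffOn_symm_of_mem_maximalAtlas he

variable {e : OpenPartialHomeomorph M (EuclideanSpace ℝ (Fin n))}

omit [IsManifold (𝓡 n) ∞ M] in
lemma isLocalDiffeomorphAt_chart (he : e ∈ IsManifold.maximalAtlas (𝓡 n) ∞ M) {x : M}
    (hx : x ∈ e.source) : IsLocalDiffeomorphAt (𝓡 n) (𝓡 n) ∞ e x :=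
  (chartDiffeo he).isLocalDiffeomorphAt _ _ _ hx

omit [IsManifold (𝓡 n) ∞ M] in
lemma isLocalDiffeomorphAt_chart_symm (he : e ∈ IsManifold.maximalAtlas (𝓡 n) ∞ M)
    {y : EuclideanSpace ℝ (Fin n)} (hy : y ∈ e.target) :
    IsLocalDiffeomorphAt (𝓡 n) (𝓡 n) ∞ e.symm y :=
  (chartDiffeo he).symm.isLocalDiffeomorphAt _ _ _ hy

omit [IsManifold (𝓡 n) ∞ M] in
lemma canonicalCoord_eq_cotangentLift (he : e ∈ IsManifold.maximalAtlas (𝓡 n) ∞ M)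
    {q : EuclideanSpace ℝ (Fin n) × EuclideanSpace ℝ (Fin n)} (hq : q.1 ∈ e.target) :
    canonicalCoord e q = cotangentLift e.symm (flatCovector q) := by
  have h := inverse_mfderiv_partialDiffeomorph (chartDiffeo he).symm hq
  unfold canonicalCoord cotangentLift flatCovector
  simp only [TotalSpace.mk.injEq, true_and]
  exact heq_of_eq (congrArg (fun L : EuclideanSpace ℝ (Fin n) →L[ℝ] EuclideanSpace ℝ (Fin n) =>
    (innerSL ℝ q.2 : EuclideanSpace ℝ (Fin n) →L[ℝ] ℝ) ∘L L) h.symm)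

lemma continuousOn_canonicalCoord (he : e ∈ IsManifold.maximalAtlas (𝓡 n) ∞ M) :
    ContinuousOn (canonicalCoord e) (e.target ×ˢ univ) := by
  have hT : IsOpen (e.target ×ˢ (univ : Set (EuclideanSpace ℝ (Fin n)))) :=
    e.open_target.prod isOpen_univ
  refine continuousOn_of_forall_continuousAt fun q hq => ?_
  have h : ContinuousAt (cotangentLift e.symm ∘ flatCovector :
      EuclideanSpace ℝ (Fin n) × EuclideanSpace ℝ (Fin n) → CotangentBundle n M) q :=
    ContinuousAt.comp (continuousAt_cotangentLift (isLocalDiffeomorphAt_chart_symm he hq.1))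
      continuous_flatCovector.continuousAt
  refine h.congr ?_
  filter_upwards [hT.mem_nhds hq] with r hr
  exact (canonicalCoord_eq_cotangentLift he hr.1).symm

end CanonicalCoord

/-! ### Lebesgue measure and cotangent lifts on `ℝⁿ` -/

section Lebesgue

variable {n : ℕ}

lemma det_adjoint_inverse {A : EuclideanSpace ℝ (Fin n) →L[ℝ] EuclideanSpace ℝ (Fin n)}
    (hA : A.IsInvertible) :
    LinearMap.det (ContinuousLinearMap.adjoint A.inverse :
      EuclideanSpace ℝ (Fin n) →ₗ[ℝ] EuclideanSpace ℝ (Fin n)) * A.det = 1 := by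
  obtain ⟨e, rfl⟩ := hA
  rw [ContinuousLinearMap.inverse_equiv]
  have h : LinearMap.det (ContinuousLinearMap.adjoint (e.symm : EuclideanSpace ℝ (Fin n) →L[ℝ]
      EuclideanSpace ℝ (Fin n)) : EuclideanSpace ℝ (Fin n) →ₗ[ℝ] EuclideanSpace ℝ (Fin n))
      = LinearMap.det ((e.symm : EuclideanSpace ℝ (Fin n) →L[ℝ]
      EuclideanSpace ℝ (Fin n)) : EuclideanSpace ℝ (Fin n) →ₗ[ℝ] EuclideanSpace ℝ (Fin n)) := by
    let b := EuclideanSpace.basisFun (Fin n) ℝ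
    have h1 := LinearMap.toMatrix_adjoint b b ((e.symm : EuclideanSpace ℝ (Fin n) →L[ℝ]
      EuclideanSpace ℝ (Fin n)) : EuclideanSpace ℝ (Fin n) →ₗ[ℝ] EuclideanSpace ℝ (Fin n))
    rw [← LinearMap.det_toMatrix b.toBasis, ← LinearMap.det_toMatrix b.toBasis]
    have h2 : (ContinuousLinearMap.adjoint (e.symm : EuclideanSpace ℝ (Fin n) →L[ℝ]
      EuclideanSpace ℝ (Fin n)) : EuclideanSpace ℝ (Fin n) →ₗ[ℝ] EuclideanSpace ℝ (Fin n))
      = LinearMap.adjoint ((e.symm : EuclideanSpace ℝ (Fin n) →L[ℝ]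
      EuclideanSpace ℝ (Fin n)) : EuclideanSpace ℝ (Fin n) →ₗ[ℝ] EuclideanSpace ℝ (Fin n)) := rfl
    rw [h2, h1, Matrix.det_conjTranspose]
    simp
  rw [h, ContinuousLinearMap.det, ← LinearMap.det_comp]
  convert LinearMap.det_id (M := EuclideanSpace ℝ (Fin n)) (A := ℝ)
  ext v
  simp

/-- The cotangent lift of a map `φ` of `ℝⁿ` in the canonical coordinates of `T^*ℝⁿ`:
`(y, η) ↦ (φ y, (dφ_y^{-1})^T η)`. -/
def flatLift (φ : EuclideanSpace ℝ (Fin n) → EuclideanSpace ℝ (Fin n))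
    (q : EuclideanSpace ℝ (Fin n) × EuclideanSpace ℝ (Fin n)) :
    EuclideanSpace ℝ (Fin n) × EuclideanSpace ℝ (Fin n) :=
  (φ q.1, ContinuousLinearMap.adjoint (fderiv ℝ φ q.1).inverse q.2)

lemma flatCovector_flatLift (φ : EuclideanSpace ℝ (Fin n) → EuclideanSpace ℝ (Fin n))
    (q : EuclideanSpace ℝ (Fin n) × EuclideanSpace ℝ (Fin n)) :
    flatCovector (flatLift φ q) = cotangentLift φ (flatCovector q) := by
  refine congrArg (TotalSpace.mk (φ q.1)) ?_
  ext1 v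
  simp only [flatCovector]
  rw [mfderiv_eq_fderiv]
  exact ContinuousLinearMap.adjoint_inner_left (fderiv ℝ φ q.1).inverse v q.2

/-- The cotangent lift of a diffeomorphism between open subsets of `ℝⁿ` preserves Lebesgue measure:
the Jacobian of `φ` on the base cancels that of the transposed inverse of `dφ` on the fibres. -/
lemma map_flatLift_volume {O : Set (EuclideanSpace ℝ (Fin n))} (hO : IsOpen O)
    {φ : EuclideanSpace ℝ (Fin n) → EuclideanSpace ℝ (Fin n)} (hφ : ContDiffOn ℝ 1 φ O)
    (hinv : ∀ y ∈ O, (fderiv ℝ φ y).IsInvertible) (hinj : InjOn φ O)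
    (hφO : MeasurableSet (φ '' O)) :
    AEMeasurable (flatLift φ) (volume.restrict (O ×ˢ univ)) ∧
    (volume.restrict (O ×ˢ univ)).map (flatLift φ) = volume.restrict ((φ '' O) ×ˢ univ) := by
  have hd : ∀ y ∈ O, HasFDerivAt φ (fderiv ℝ φ y) y := fun y hy =>
    ((hφ.differentiableOn (by simp)).differentiableAt (hO.mem_nhds hy)).hasFDerivAt
  have hcont : ContinuousOn (flatLift φ) (O ×ˢ univ) := by
    have h1 : ContinuousOn (fun y => (fderiv ℝ φ y).inverse) O := fun y hy => by
      have h : ContinuousAt (ContinuousLinearMap.inverse :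
          (EuclideanSpace ℝ (Fin n) →L[ℝ] EuclideanSpace ℝ (Fin n)) → _) (fderiv ℝ φ y) :=
        ((hinv y hy).contDiffAt_map_inverse (n := 0)).continuousAt
      exact h.comp_continuousWithinAt (hφ.continuousOn_fderiv_of_isOpen hO (by simp) y hy)
    have h2 : ContinuousOn (fun q : EuclideanSpace ℝ (Fin n) × EuclideanSpace ℝ (Fin n) =>
        ContinuousLinearMap.adjoint (fderiv ℝ φ q.1).inverse) (O ×ˢ univ) :=
      (ContinuousLinearMap.adjoint (𝕜 := ℝ) (E := EuclideanSpace ℝ (Fin n))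
        (F := EuclideanSpace ℝ (Fin n))).continuous.comp_continuousOn
        (h1.comp continuousOn_fst fun q hq => hq.1)
    exact (hφ.continuousOn.comp continuousOn_fst fun q hq => hq.1).prodMk
      (h2.clm_apply continuousOn_snd)
  have hOm : MeasurableSet (O ×ˢ (univ : Set (EuclideanSpace ℝ (Fin n)))) :=
    hO.measurableSet.prod .univ
  have hae := hcont.aemeasurable (μ := volume) hOm
  refine ⟨hae, ?_⟩
  ext B hB
  have hS : MeasurableSet (flatLift φ ⁻¹' B ∩ O ×ˢ univ) := by
    have h1 : Measurable ((O ×ˢ univ).domRestrict (flatLift φ)) :=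
      (continuousOn_iff_continuous_domRestrict.1 hcont).measurable
    have := (MeasurableEmbedding.subtype_coe hOm).measurableSet_image' (h1 hB)
    rwa [domRestrict_eq, preimage_comp, Subtype.image_preimage_coe, inter_comm] at this
  rw [Measure.map_apply_of_aemeasurable hae hB, Measure.restrict_apply' hOm,
    Measure.restrict_apply hB, Measure.volume_eq_prod, Measure.prod_apply hS,
    Measure.prod_apply (hB.inter (hφO.prod .univ))]
  have hL : ∀ y, volume (Prod.mk y ⁻¹' (flatLift φ ⁻¹' B ∩ O ×ˢ univ))
      = O.indicator (fun y => ENNReal.ofReal |(fderiv ℝ φ y).det| *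
        volume (Prod.mk (φ y) ⁻¹' B)) y := by
    intro y
    by_cases hy : y ∈ O
    · rw [indicator_of_mem hy]
      have hdet := det_adjoint_inverse (hinv y hy)
      have h0 := left_ne_zero_of_mul_eq_one hdet
      have hset : Prod.mk y ⁻¹' (flatLift φ ⁻¹' B ∩ O ×ˢ univ)
          = (ContinuousLinearMap.adjoint (fderiv ℝ φ y).inverse) ⁻¹' (Prod.mk (φ y) ⁻¹' B) := by
        ext η
        simp [flatLift, hy]
      rw [hset, Measure.addHaar_preimage_continuousLinearMap volume h0,
        inv_eq_of_mul_eq_one_right hdet]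
    · rw [indicator_of_notMem hy]
      have hset : Prod.mk y ⁻¹' (flatLift φ ⁻¹' B ∩ O ×ˢ univ) = ∅ := by
        ext η
        simp [hy]
      rw [hset, measure_empty]
  have hR : ∀ u, volume (Prod.mk u ⁻¹' (B ∩ (φ '' O) ×ˢ univ))
      = (φ '' O).indicator (fun u => volume (Prod.mk u ⁻¹' B)) u := by
    intro u
    by_cases hu : u ∈ φ '' O
    · rw [indicator_of_mem hu]
      congr 1
      ext η
      simp only [mem_preimage, mem_inter_iff, mem_prod, mem_univ, and_true]
      exact and_iff_left hu
    · rw [indicator_of_notMem hu]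
      convert measure_empty (μ := volume)
      ext η
      simp only [mem_preimage, mem_inter_iff, mem_prod, mem_univ, and_true, mem_empty_iff_false,
        iff_false]
      exact fun h => hu h.2
  simp_rw [hL, hR]
  rw [lintegral_indicator hO.measurableSet, lintegral_indicator hφO,
    lintegral_image_eq_lintegral_abs_det_fderiv_mul volume hO.measurableSet
      (fun y hy => (hd y hy).hasFDerivWithinAt) hinj]

end Lebesgue

/-! ### The symplectic volume -/

section SymplecticVolume

variable {n : ℕ} {M : Type*} [TopologicalSpace M] [ChartedSpace (EuclideanSpace ℝ (Fin n)) M]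
  [IsManifold (𝓡 n) ∞ M]
  {N : Type*} [TopologicalSpace N] [ChartedSpace (EuclideanSpace ℝ (Fin n)) N]
  [IsManifold (𝓡 n) ∞ N]

lemma measurableSet_over {U : Set M} (hU : IsOpen U) :
    MeasurableSet {z : CotangentBundle n M | z.1 ∈ U} :=
  (hU.preimage continuous_cotangentBundle_proj).measurableSet

/-- Lebesgue measure in the canonical coordinates of `T^*M` given by a chart of `M`. -/
def chartMeasure (e : OpenPartialHomeomorph M (EuclideanSpace ℝ (Fin n))) :
    Measure (CotangentBundle n M) :=
  ((volume : Measure (EuclideanSpace ℝ (Fin n) × EuclideanSpace ℝ (Fin n))).restrict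
    (e.target ×ˢ univ)).map (canonicalCoord e)

lemma symplecticVolume_eq_iSup :
    symplecticVolume n M = ⨆ e ∈ IsManifold.maximalAtlas (𝓡 n) ∞ M, chartMeasure e := rfl

lemma aemeasurable_canonicalCoord {e : OpenPartialHomeomorph M (EuclideanSpace ℝ (Fin n))}
    (he : e ∈ IsManifold.maximalAtlas (𝓡 n) ∞ M) :
    AEMeasurable (canonicalCoord e) (volume.restrict (e.target ×ˢ univ)) :=
  (continuousOn_canonicalCoord he).aemeasurable (e.open_target.prod isOpen_univ).measurableSet

lemma chartMeasure_restrict {e : OpenPartialHomeomorph M (EuclideanSpace ℝ (Fin n))}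
    (he : e ∈ IsManifold.maximalAtlas (𝓡 n) ∞ M) {U : Set M} (hU : IsOpen U)
    (hUe : U ⊆ e.source) :
    (chartMeasure e).restrict {z | z.1 ∈ U}
      = (volume.restrict ((e '' U) ×ˢ univ)).map (canonicalCoord e) := by
  have hT : MeasurableSet (e.target ×ˢ (univ : Set (EuclideanSpace ℝ (Fin n)))) :=
    (e.open_target.prod isOpen_univ).measurableSet
  rw [chartMeasure, Measure.restrict_map_of_aemeasurable (aemeasurable_canonicalCoord he)
    (measurableSet_over hU), Measure.restrict_restrict' hT]
  congr 2
  ext ⟨y, η⟩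
  simp only [mem_inter_iff, mem_preimage, mem_prod, mem_univ, and_true, mem_image]
  constructor
  · exact fun ⟨h1, h2⟩ => ⟨e.symm y, h1, e.right_inv h2⟩
  · rintro ⟨x, hx, rfl⟩
    refine ⟨?_, e.map_source (hUe hx)⟩
    show e.symm (e x) ∈ U
    rwa [e.left_inv (hUe hx)]

/-- A local diffeomorphism `p` that is injective on `U` carries the chart measure of `U` to the
chart measure of `p '' U`. -/
lemma map_cotangentLift_chartMeasure {p : M → N} (hp : IsLocalDiffeomorph (𝓡 n) (𝓡 n) ∞ p)
    {e : OpenPartialHomeomorph M (EuclideanSpace ℝ (Fin n))}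
    (he : e ∈ IsManifold.maximalAtlas (𝓡 n) ∞ M)
    {e' : OpenPartialHomeomorph N (EuclideanSpace ℝ (Fin n))}
    (he' : e' ∈ IsManifold.maximalAtlas (𝓡 n) ∞ N) {U : Set M} (hU : IsOpen U)
    (hinj : InjOn p U) (hUe : U ⊆ e.source) (hUe' : p '' U ⊆ e'.source) :
    ((chartMeasure e).restrict {z | z.1 ∈ U}).map (cotangentLift p)
      = (chartMeasure e').restrict {w | w.1 ∈ p '' U} := by
  have hpU : IsOpen (p '' U) := hp.isOpenMap U hU
  set O := e '' U
  have hOo : IsOpen O := e.isOpen_image_of_subset_source hU hUe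
  have hOs : ∀ y ∈ O, y ∈ e.target ∧ e.symm y ∈ U := by
    rintro _ ⟨x, hx, rfl⟩
    exact ⟨e.map_source (hUe hx), by rwa [e.left_inv (hUe hx)]⟩
  set φ : EuclideanSpace ℝ (Fin n) → EuclideanSpace ℝ (Fin n) := e' ∘ p ∘ e.symm
  have hes : ∀ y ∈ O, IsLocalDiffeomorphAt (𝓡 n) (𝓡 n) ∞ e.symm y :=
    fun y hy => isLocalDiffeomorphAt_chart_symm he (hOs y hy).1
  have hpe : ∀ y ∈ O, p (e.symm y) ∈ e'.source := fun y hy => hUe' ⟨_, (hOs y hy).2, rfl⟩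
  have hφd : ∀ y ∈ O, IsLocalDiffeomorphAt (𝓡 n) (𝓡 n) ∞ φ y := fun y hy =>
    ((hes y hy).comp (P := N) (K := 𝓡 n) (hp _)).comp (P := EuclideanSpace ℝ (Fin n)) (K := 𝓡 n)
      (isLocalDiffeomorphAt_chart he' (hpe y hy))
  have hφO : φ '' O = e' '' (p '' U) := by
    rw [← image_comp, ← image_comp]
    refine image_congr fun x hx => ?_
    simp only [φ, Function.comp_apply]
    rw [e.left_inv (hUe hx)]
  have hφOo : IsOpen (φ '' O) := by
    rw [hφO]
    exact e'.isOpen_image_of_subset_source hpU hUe'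
  have hφinj : InjOn φ O := by
    intro y hy y' hy' h
    have h1 := e'.injOn (hpe y hy) (hpe y' hy') h
    have h2 := hinj (hOs y hy).2 (hOs y' hy').2 h1
    exact e.symm.injOn (hOs y hy).1 (hOs y' hy').1 h2
  obtain ⟨hae, hvol⟩ := map_flatLift_volume hOo (φ := φ)
    (fun y hy => ((hφd y hy).contMDiffAt.contDiffAt.of_le (by simp)).contDiffWithinAt)
    (fun y hy => by
      rw [← mfderiv_eq_fderiv]
      exact ⟨(hφd y hy).mfderivToContinuousLinearEquiv (by simp), rfl⟩)
    hφinj hφOo.measurableSet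
  have hOm : MeasurableSet (O ×ˢ (univ : Set (EuclideanSpace ℝ (Fin n)))) :=
    (hOo.prod isOpen_univ).measurableSet
  have hcc : AEMeasurable (canonicalCoord e) (volume.restrict (O ×ˢ univ)) :=
    (aemeasurable_canonicalCoord he).mono_measure (Measure.restrict_mono_set _
      (prod_mono_left fun y hy => (hOs y hy).1))
  have hcc' : AEMeasurable (canonicalCoord e') (volume.restrict ((φ '' O) ×ˢ univ)) := by
    refine (aemeasurable_canonicalCoord he').mono_measure (Measure.restrict_mono_set _
      (prod_mono_left ?_))
    rintro _ ⟨y, hy, rfl⟩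
    exact e'.map_source (hpe y hy)
  rw [chartMeasure_restrict he hU hUe, chartMeasure_restrict he' hpU hUe', ← hφO, ← hvol,
    AEMeasurable.map_map_of_aemeasurable
      (continuous_cotangentLift hp).measurable.aemeasurable hcc,
    AEMeasurable.map_map_of_aemeasurable (by rwa [hvol]) hae]
  refine Measure.map_congr ?_
  filter_upwards [ae_restrict_mem hOm] with q hq
  have hy := hq.1
  have h1 : (flatLift φ q).1 ∈ e'.target := e'.map_source (hpe _ hy)
  rw [Function.comp_apply, Function.comp_apply, canonicalCoord_eq_cotangentLift he (hOs _ hy).1,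
    canonicalCoord_eq_cotangentLift he' h1, flatCovector_flatLift,
    ← cotangentLift_comp (z := flatCovector q) (hp _) (hes _ hy),
    ← cotangentLift_comp (z := flatCovector q) (isLocalDiffeomorphAt_chart_symm he' h1)
      (hφd _ hy)]
  refine cotangentLift_congr ?_
  filter_upwards [hOo.mem_nhds hy] with y hy
  simp only [φ, Function.comp_apply]
  rw [e'.left_inv (hpe y hy)]

/-- An upper bound for a supremum of measures can be checked on a part `t` of the space: the bound
on `t`, together with the supremum itself off `t`, bounds all the measures. -/
lemma restrict_biSup_le {α ι : Type*} [MeasurableSpace α] {S : Set ι} {m : ι → Measure α}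
    {ν : Measure α} {t : Set α} (ht : MeasurableSet t) (h : ∀ i ∈ S, (m i).restrict t ≤ ν) :
    (⨆ i ∈ S, m i).restrict t ≤ ν := by
  have h1 : (⨆ i ∈ S, m i) ≤ ν.restrict t + (⨆ i ∈ S, m i).restrict tᶜ := by
    refine iSup₂_le fun i hi => ?_
    rw [← Measure.restrict_add_restrict_compl (μ := m i) ht]
    refine add_le_add ?_ (Measure.restrict_mono subset_rfl (le_iSup₂_of_le i hi le_rfl))
    calc (m i).restrict t = ((m i).restrict t).restrict t := by
          rw [Measure.restrict_restrict ht, inter_self]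
      _ ≤ ν.restrict t := Measure.restrict_mono subset_rfl (h i hi)
  calc (⨆ i ∈ S, m i).restrict t
      ≤ (ν.restrict t + (⨆ i ∈ S, m i).restrict tᶜ).restrict t :=
        Measure.restrict_mono subset_rfl h1
    _ = ν.restrict t := by
        rw [Measure.restrict_add, Measure.restrict_restrict ht, Measure.restrict_restrict ht]
        simp
    _ ≤ ν := Measure.restrict_le_self

/-- Over the domain of a chart the symplectic volume is the chart measure. -/
lemma symplecticVolume_restrict_source {e : OpenPartialHomeomorph M (EuclideanSpace ℝ (Fin n))}
    (he : e ∈ IsManifold.maximalAtlas (𝓡 n) ∞ M) :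
    (symplecticVolume n M).restrict {z | z.1 ∈ e.source}
      = (chartMeasure e).restrict {z | z.1 ∈ e.source} := by
  refine le_antisymm ?_ (Measure.restrict_mono subset_rfl ?_)
  · rw [symplecticVolume_eq_iSup]
    refine restrict_biSup_le (measurableSet_over e.open_source) fun e' he' => ?_
    have hid : IsLocalDiffeomorph (𝓡 n) (𝓡 n) ∞ (id : M → M) :=
      (Diffeomorph.refl (𝓡 n) M ∞).isLocalDiffeomorph
    have h := map_cotangentLift_chartMeasure hid he' he (e'.open_source.inter e.open_source)
      (injOn_id _) inter_subset_left (by rw [image_id]; exact inter_subset_right)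
    have h2 : (cotangentLift (id : M → M) : CotangentBundle n M → CotangentBundle n M) = id :=
      funext cotangentLift_id
    rw [h2, Measure.map_id, image_id] at h
    -- the measure of the chart `e'` is concentrated over the domain of `e'`
    have h3 : chartMeasure e' = (chartMeasure e').restrict {z | z.1 ∈ e'.source} := by
      rw [chartMeasure_restrict he' e'.open_source subset_rfl, e'.image_source_eq_target]
      rfl
    rw [h3, Measure.restrict_restrict (measurableSet_over e.open_source)]
    have h4 : {z : CotangentBundle n M | z.1 ∈ e.source} ∩ {z | z.1 ∈ e'.source}
      = {z | z.1 ∈ e'.source ∩ e.source} := by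
      ext z; simp only [mem_inter_iff, mem_ofPred_eq]; exact and_comm
    rw [h4, h]
    exact Measure.restrict_mono (fun z hz => hz.2) le_rfl
  · rw [symplecticVolume_eq_iSup]
    exact le_iSup₂_of_le e he le_rfl

/-- The lift of a local diffeomorphism that is injective on `U` preserves the symplectic volume
over `U`. -/
lemma map_cotangentLift_symplecticVolume_of_injOn [SecondCountableTopology M] {p : M → N}
    (hp : IsLocalDiffeomorph (𝓡 n) (𝓡 n) ∞ p) {U : Set M} (hU : IsOpen U) (hinj : InjOn p U) :
    ((symplecticVolume n M).restrict {z | z.1 ∈ U}).map (cotangentLift p)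
      = (symplecticVolume n N).restrict {w | w.1 ∈ p '' U} := by
  have hP := (continuous_cotangentLift hp).measurable
  -- over small open subsets of `U` the claim is the one for chart measures
  let V : M → Set M := fun x => U ∩ ((chartAt (EuclideanSpace ℝ (Fin n)) x).source ∩
    p ⁻¹' (chartAt (EuclideanSpace ℝ (Fin n)) (p x)).source)
  have hVo : ∀ x, IsOpen (V x) := fun x => hU.inter ((chartAt _ x).open_source.inter
    ((chartAt _ (p x)).open_source.preimage hp.contMDiff.continuous))
  have hVx : ∀ x ∈ U, x ∈ V x := fun x hx => ⟨hx, mem_chart_source _ x, mem_chart_source _ (p x)⟩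
  have hV : ∀ x, ((symplecticVolume n M).restrict {z | z.1 ∈ V x}).map (cotangentLift p)
      = (symplecticVolume n N).restrict {w | w.1 ∈ p '' V x} := by
    intro x
    have he := IsManifold.chart_mem_maximalAtlas (I := 𝓡 n) (n := ∞) x
    have he' := IsManifold.chart_mem_maximalAtlas (I := 𝓡 n) (n := ∞) (p x)
    have h := map_cotangentLift_chartMeasure hp he he' (hVo x) (hinj.mono inter_subset_left)
      (fun y hy => hy.2.1) (by rintro _ ⟨y, hy, rfl⟩; exact hy.2.2)
    have h1 := congrArg (fun μ => μ.restrict {z : CotangentBundle n M | z.1 ∈ V x})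
      (symplecticVolume_restrict_source he)
    have h2 := congrArg (fun μ => μ.restrict {z : CotangentBundle n N | z.1 ∈ p '' V x})
      (symplecticVolume_restrict_source he')
    beta_reduce at h1 h2
    rw [Measure.restrict_restrict_of_subset (fun z hz => hz.2.1),
      Measure.restrict_restrict_of_subset (fun z hz => hz.2.1)] at h1
    have hs : {w : CotangentBundle n N | w.1 ∈ p '' V x}
        ⊆ {w | w.1 ∈ (chartAt (EuclideanSpace ℝ (Fin n)) (p x)).source} := by
      rintro w ⟨y, hy, hw⟩
      rw [mem_ofPred_eq, ← hw]
      exact hy.2.2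
    rw [Measure.restrict_restrict_of_subset hs, Measure.restrict_restrict_of_subset hs] at h2
    rw [h1, h2, h]
  obtain ⟨s, hsU, hs, hcov⟩ := TopologicalSpace.countable_cover_nhdsWithin
    (fun x hx => mem_nhdsWithin_of_mem_nhds ((hVo x).mem_nhds (hVx x hx)))
  have hUeq : U = ⋃ x ∈ s, V x :=
    subset_antisymm hcov (iUnion₂_subset fun x _ => inter_subset_left)
  have := hs.to_subtype
  have hW : ∀ W ⊆ U, IsOpen W →
      (((symplecticVolume n M).restrict {z | z.1 ∈ U}).map (cotangentLift p)).restrict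
        {w | w.1 ∈ p '' W}
      = ((symplecticVolume n M).restrict {z | z.1 ∈ W}).map (cotangentLift p) := by
    intro W hWU hW
    have hm := measurableSet_over (n := n) (hp.isOpenMap W hW)
    rw [Measure.restrict_map hP hm, Measure.restrict_restrict (hP hm)]
    congr 2
    ext z
    simp only [mem_inter_iff, mem_preimage, mem_ofPred_eq]
    exact ⟨fun ⟨⟨x, hx, hxz⟩, hz⟩ => hinj (hWU hx) hz hxz ▸ hx, fun h => ⟨⟨_, h, rfl⟩, hWU h⟩⟩
  have hc : {w : CotangentBundle n N | w.1 ∈ p '' U} = ⋃ x : s, {w | w.1 ∈ p '' V x} := by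
    ext w
    have : p '' U = ⋃ x ∈ s, p '' V x := by rw [← image_iUnion₂, ← hUeq]
    simp only [this, mem_ofPred_eq, mem_iUnion, exists_prop, Subtype.exists]
  rw [← hW U subset_rfl hU, hc]
  refine Measure.restrict_iUnion_congr.2 fun x => ?_
  rw [hW _ inter_subset_left (hVo x), hV]

/-- The lift of a smooth quotient covering by a finite group `K` multiplies the symplectic volume
by the order of `K`. -/
lemma map_cotangentLift_symplecticVolume [SecondCountableTopology M] {K : Type*} [Group K]
    [Finite K] [MulAction K M] {p : M → N} (hK : IsQuotientCoveringMap p K)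
    (hp : IsLocalDiffeomorph (𝓡 n) (𝓡 n) ∞ p) :
    (symplecticVolume n M).map (cotangentLift p)
      = (Nat.card K : ℝ≥0∞) • symplecticVolume n N := by
  have hP := (continuous_cotangentLift hp).measurable
  have := Fintype.ofFinite K
  have := hK.toContinuousConstSMul
  have := hK.isCancelSMul
  choose U hUo hxU hU using exists_isOpen_injOn hp
  obtain ⟨s, hs, hcov⟩ := TopologicalSpace.countable_cover_nhds fun x => (hUo x).mem_nhds (hxU x)
  have := hs.to_subtype
  have huniv : (⋃ x : s, {w : CotangentBundle n N | w.1 ∈ p '' U x}) = univ := by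
    refine eq_univ_of_forall fun w => ?_
    obtain ⟨y, hy⟩ := hK.surjective w.1
    have : y ∈ ⋃ x ∈ s, U x := hcov ▸ mem_univ _
    simp only [mem_iUnion, exists_prop] at this
    obtain ⟨x, hx, hyx⟩ := this
    exact mem_iUnion.2 ⟨⟨x, hx⟩, y, hyx, hy⟩
  refine Measure.ext_of_iUnion_eq_univ huniv fun x => ?_
  have hUx := hUo x
  have hm := measurableSet_over (n := n) (hp.isOpenMap _ hUx)
  -- the preimage of `p '' U x` is the disjoint union of the translates of `U x`
  let V : K → Set M := fun k => (fun y => k • y) '' U x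
  have hVo : ∀ k, IsOpen (V k) := fun k => isOpenMap_smul k _ hUx
  have hpV : ∀ k, p '' V k = p '' U x := fun k => by
    rw [← image_comp]
    exact image_congr fun y _ => hK.map_smul k
  have hVinj : ∀ k, InjOn p (V k) := by
    rintro k _ ⟨y, hy, rfl⟩ _ ⟨y', hy', rfl⟩ h
    simp only [hK.map_smul] at h
    rw [hU x hy hy' h]
  have hpre : cotangentLift p ⁻¹' {w : CotangentBundle n N | w.1 ∈ p '' U x}
      = ⋃ k, {z : CotangentBundle n M | z.1 ∈ V k} := by
    ext z
    simp only [mem_preimage, mem_ofPred_eq, mem_iUnion]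
    constructor
    · rintro ⟨y, hy, hyz⟩
      obtain ⟨k, hk⟩ := hK.apply_eq_iff_mem_orbit.1 hyz.symm
      exact ⟨k, y, hy, hk⟩
    · rintro ⟨k, y, hy, hk⟩
      refine ⟨y, hy, ?_⟩
      show p y = p z.1
      rw [← hk]
      exact (hK.map_smul k).symm
  have hdisj : Pairwise (Function.onFun Disjoint
      fun k => {z : CotangentBundle n M | z.1 ∈ V k}) := by
    intro k l hkl
    refine disjoint_left.2 ?_
    rintro z ⟨y, hy, hk⟩ ⟨y', hy', hl⟩
    have h : p y = p y' := by
      rw [← hK.map_smul k, ← hK.map_smul l (e := y')]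
      exact congrArg p (hk.trans hl.symm)
    obtain rfl := hU x hy hy' h
    exact hkl (IsCancelSMul.right_cancel _ _ _ (hk.trans hl.symm))
  rw [Measure.restrict_map hP hm, hpre,
    Measure.restrict_iUnion hdisj fun k => measurableSet_over (hVo k), Measure.sum_fintype,
    Measure.map_finset_sum hP.aemeasurable, Measure.restrict_smul]
  simp_rw [map_cotangentLift_symplecticVolume_of_injOn hp (hVo _) (hVinj _), hpV]
  rw [Finset.sum_const, Finset.card_univ, Nat.card_eq_fintype_card, ← Nat.cast_smul_eq_nsmul ℝ≥0∞]

end SymplecticVolume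

/-! ### Measurability of the dual norm -/

section Conorm

variable {n : ℕ} {M : Type*} [TopologicalSpace M] [ChartedSpace (EuclideanSpace ℝ (Fin n)) M]
  [IsManifold (𝓡 n) ∞ M]

lemma bddAbove_conorm (g : ContMDiffRiemannianMetric (𝓡 n) ∞ (EuclideanSpace ℝ (Fin n))
      (fun x : M => TangentSpace (𝓡 n) x)) (x : M) (ξ : CotangentSpace n x) :
    BddAbove {t : ℝ | ∃ v : TangentSpace (𝓡 n) x, g.inner x v v ≤ 1 ∧ ξ v = t} := by
  have h := (g.isVonNBounded x).image (σ := RingHom.id ℝ) (F := ℝ) ξ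
  rw [NormedSpace.isVonNBounded_iff] at h
  obtain ⟨C, hC⟩ := h.exists_norm_le
  refine ⟨2 * C, ?_⟩
  rintro _ ⟨v, hv, rfl⟩
  have h1 : g.inner x ((2⁻¹ : ℝ) • v) ((2⁻¹ : ℝ) • v) < 1 := by
    simp only [map_smul, smul_apply, smul_eq_mul]
    linarith
  have h2 := hC _ ⟨_, h1, rfl⟩
  have h3 : ξ ((2⁻¹ : ℝ) • v) = 2⁻¹ * ξ v := map_smul ξ _ v
  rw [h3, Real.norm_eq_abs] at h2
  linarith [le_abs_self (2⁻¹ * ξ v)]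

/-- The dual norm of a Riemannian metric is lower semicontinuous on `T^*M`, as a supremum of
functions `ξ ↦ ξ(v)` where `v` can be taken to depend continuously on the base point. -/
lemma lowerSemicontinuous_conorm
    (g : ContMDiffRiemannianMetric (𝓡 n) ∞ (EuclideanSpace ℝ (Fin n))
      (fun x : M => TangentSpace (𝓡 n) x)) :
    LowerSemicontinuous
      (fun z : CotangentBundle n M => conorm (fun x v w => g.inner x v w) z.1 z.2) := by
  intro z₀ t ht
  obtain ⟨_, ⟨v₀, hv₀, rfl⟩, hv₀t⟩ := exists_lt_of_lt_csSup
    (s := {t : ℝ | ∃ v : TangentSpace (𝓡 n) z₀.1, g.inner z₀.1 v v ≤ 1 ∧ z₀.2 v = t})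
    ⟨0, 0, by simp, by simp⟩ ht
  have h1 : ∀ᶠ c in 𝓝[<] (1 : ℝ), t < c * z₀.2 v₀ := by
    have hc : Continuous fun c : ℝ => c * (z₀.2 v₀ : ℝ) := by fun_prop
    exact nhdsWithin_le_nhds (hc.continuousAt.eventually (lt_mem_nhds (by simpa using hv₀t)))
  have h2 : ∀ᶠ c in 𝓝[<] (1 : ℝ), c ∈ Ioo (0 : ℝ) 1 := Ioo_mem_nhdsLT one_pos
  obtain ⟨c, hct, hc0, hc1⟩ := (h1.and h2).exists
  let τ := trivializationAt (EuclideanSpace ℝ (Fin n)) (TangentSpace (𝓡 n) : M → Type _) z₀.1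
  have hx : z₀.1 ∈ τ.baseSet := mem_baseSet_trivializationAt _ _ _
  let u : EuclideanSpace ℝ (Fin n) := τ.continuousLinearMapAt ℝ z₀.1 (c • v₀)
  have hu : localSection z₀.1 u z₀.1 = c • v₀ := τ.symmL_continuousLinearMapAt hx _
  have hV : ContinuousAt (fun z : CotangentBundle n M =>
      (⟨z.1, localSection z₀.1 u z.1⟩ : TangentBundle (𝓡 n) M)) z₀ :=
    ContinuousAt.comp (f := fun z : CotangentBundle n M => z.1)
      (continuousAt_localSection z₀.1 u) continuous_cotangentBundle_proj.continuousAt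
  have hξ : ContinuousAt (fun z : CotangentBundle n M => (z.2 (localSection z₀.1 u z.1) : ℝ)) z₀ :=
    continuousAt_pairing (ξ := fun z : CotangentBundle n M => z.2) continuousAt_id hV
  have hgV : ContinuousAt (fun z : CotangentBundle n M =>
      (g.inner z.1 (localSection z₀.1 u z.1) (localSection z₀.1 u z.1) : ℝ)) z₀ := by
    have hg : ContinuousAt (fun z : CotangentBundle n M => TotalSpace.mk'
        (EuclideanSpace ℝ (Fin n) →L[ℝ] EuclideanSpace ℝ (Fin n) →L[ℝ] ℝ)
        (E := fun x : M => TangentSpace (𝓡 n) x →L[ℝ] TangentSpace (𝓡 n) x →L[ℝ] ℝ)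
        z.1 (g.inner z.1)) z₀ :=
      ContinuousAt.comp (f := fun z : CotangentBundle n M => z.1)
        g.contMDiff.continuous.continuousAt continuous_cotangentBundle_proj.continuousAt
    have := ContinuousAt.clm_bundle_apply₂ (F₁ := EuclideanSpace ℝ (Fin n))
      (F₂ := EuclideanSpace ℝ (Fin n)) (F₃ := ℝ) (E₁ := (TangentSpace (𝓡 n) : M → Type _))
      (E₂ := (TangentSpace (𝓡 n) : M → Type _)) (E₃ := Bundle.Trivial M ℝ) hg hV hV
    rw [FiberBundle.continuousAt_totalSpace] at this
    exact this.2
  have e1 : ∀ᶠ z : CotangentBundle n M in 𝓝 z₀, t < z.2 (localSection z₀.1 u z.1) := by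
    refine hξ.eventually (lt_mem_nhds ?_)
    beta_reduce
    rw [hu]
    exact hct.trans_eq (map_smul z₀.2 c v₀).symm
  have e2 : ∀ᶠ z : CotangentBundle n M in 𝓝 z₀,
      g.inner z.1 (localSection z₀.1 u z.1) (localSection z₀.1 u z.1) < 1 := by
    refine hgV.eventually (gt_mem_nhds ?_)
    beta_reduce
    rw [hu]
    simp only [map_smul, smul_apply, smul_eq_mul]
    calc c * (c * g.inner z₀.1 v₀ v₀) ≤ c * (c * 1) := by gcongr
      _ < 1 := by nlinarith
  filter_upwards [e1, e2] with z hz1 hz2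
  exact hz1.trans_le (le_csSup (bddAbove_conorm g z.1 z.2) ⟨_, hz2.le, rfl⟩)

lemma measurable_conorm
    (g : ContMDiffRiemannianMetric (𝓡 n) ∞ (EuclideanSpace ℝ (Fin n))
      (fun x : M => TangentSpace (𝓡 n) x)) :
    Measurable (fun z : CotangentBundle n M => conorm (fun x v w => g.inner x v w) z.1 z.2) :=
  (lowerSemicontinuous_conorm g).measurable

end Conorm

/-! ### The Liouville measure under coverings -/

section Liouville

variable {n : ℕ} {M : Type*} [TopologicalSpace M] [ChartedSpace (EuclideanSpace ℝ (Fin n)) M]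
  [IsManifold (𝓡 n) ∞ M]
  {N : Type*} [TopologicalSpace N] [ChartedSpace (EuclideanSpace ℝ (Fin n)) N]
  [IsManifold (𝓡 n) ∞ N]

lemma measurable_conorm_pullbackForm {p : M → N} (hp : IsLocalDiffeomorph (𝓡 n) (𝓡 n) ∞ p)
    {g : FormField n N} (hg : Measurable fun z : CotangentBundle n N => conorm g z.1 z.2) :
    Measurable fun z : CotangentBundle n M => conorm (pullbackForm p g) z.1 z.2 := by
  simp_rw [← conorm_cotangentLift hp]
  exact hg.comp (continuous_cotangentLift hp).measurable

lemma measurableEmbedding_cosphereBundle {g : FormField n M}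
    (hg : Measurable fun z : CotangentBundle n M => conorm g z.1 z.2) :
    MeasurableEmbedding (fun z : CosphereBundle g => (z.1 : CotangentBundle n M)) :=
  MeasurableEmbedding.subtype_coe (hg (measurableSet_singleton 1))

lemma measurable_radialProj {g : FormField n M}
    (hg : Measurable fun z : CotangentBundle n M => conorm g z.1 z.2) :
    Measurable (radialProj g) := by
  refine Measurable.subtype_mk ?_
  have h1 : Measurable fun z : {z : CotangentBundle n M // 0 < conorm g z.1 z.2 ∧
      conorm g z.1 z.2 < 1} => ((conorm g z.1.1 z.1.2)⁻¹, z.1) :=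
    ((hg.comp measurable_subtype_coe).inv).prodMk measurable_subtype_coe
  exact continuous_smul_cotangent.measurable.comp h1

lemma measurable_cosphereLift {p : M → N} (hp : IsLocalDiffeomorph (𝓡 n) (𝓡 n) ∞ p)
    {gM : FormField n M} {gN : FormField n N} (hg : pullbackForm p gN = gM) :
    Measurable (cosphereLift p hp hg) :=
  Measurable.subtype_mk ((continuous_cotangentLift hp).measurable.comp measurable_subtype_coe)

lemma measurableSet_image_cosphereLift [SecondCountableTopology M] {p : M → N}
    (hp : IsLocalDiffeomorph (𝓡 n) (𝓡 n) ∞ p)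
    {gM : FormField n M} {gN : FormField n N} (hg : pullbackForm p gN = gM)
    (hm : Measurable fun z : CotangentBundle n N => conorm gN z.1 z.2)
    {S : Set (CosphereBundle gM)} (hS : MeasurableSet S) :
    MeasurableSet (cosphereLift p hp hg '' S) := by
  have hmM : Measurable fun z : CotangentBundle n M => conorm gM z.1 z.2 :=
    hg ▸ measurable_conorm_pullbackForm hp hm
  have h := measurableSet_image_cotangentLift hp
    ((measurableEmbedding_cosphereBundle hmM).measurableSet_image' hS)
  rw [← (measurableEmbedding_cosphereBundle hm).measurableSet_image]
  rw [image_image] at h ⊢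
  exact h

/-- The lift of a smooth quotient covering by a finite group `K`, isometric for the metrics,
multiplies the Liouville measure by the order of `K`. -/
lemma map_cosphereLift_liouvilleMeasure [SecondCountableTopology M] {K : Type*} [Group K]
    [Finite K] [MulAction K M] {p : M → N} (hK : IsQuotientCoveringMap p K)
    (hp : IsLocalDiffeomorph (𝓡 n) (𝓡 n) ∞ p)
    {gM : FormField n M} {gN : FormField n N} (hg : pullbackForm p gN = gM)
    (hm : Measurable fun z : CotangentBundle n N => conorm gN z.1 z.2) :
    (liouvilleMeasure gM).map (cosphereLift p hp hg)
      = (Nat.card K : ℝ≥0∞) • liouvilleMeasure gN := by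
  have hmM : Measurable fun z : CotangentBundle n M => conorm gM z.1 z.2 :=
    hg ▸ measurable_conorm_pullbackForm hp hm
  have hcon : ∀ z : CotangentBundle n M, conorm gN (cotangentLift p z).1 (cotangentLift p z).2
      = conorm gM z.1 z.2 := fun z => by rw [conorm_cotangentLift hp, hg]
  have hDM : MeasurableSet {z : CotangentBundle n M | 0 < conorm gM z.1 z.2 ∧
      conorm gM z.1 z.2 < 1} := hmM measurableSet_Ioo
  have hDN : MeasurableSet {z : CotangentBundle n N | 0 < conorm gN z.1 z.2 ∧
      conorm gN z.1 z.2 < 1} := hm measurableSet_Ioo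
  have eM : MeasurableEmbedding (Subtype.val : {z : CotangentBundle n M //
      0 < conorm gM z.1 z.2 ∧ conorm gM z.1 z.2 < 1} → _) := .subtype_coe hDM
  have eN : MeasurableEmbedding (Subtype.val : {z : CotangentBundle n N //
      0 < conorm gN z.1 z.2 ∧ conorm gN z.1 z.2 < 1} → _) := .subtype_coe hDN
  -- the lift of `p` to the punctured codisc bundles
  let PD : {z : CotangentBundle n M // 0 < conorm gM z.1 z.2 ∧ conorm gM z.1 z.2 < 1} →
      {z : CotangentBundle n N // 0 < conorm gN z.1 z.2 ∧ conorm gN z.1 z.2 < 1} :=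
    fun z => ⟨cotangentLift p z.1, by rw [hcon]; exact z.2⟩
  have hPD : Measurable PD := Measurable.subtype_mk
    ((continuous_cotangentLift hp).measurable.comp measurable_subtype_coe)
  have hcomm : cosphereLift p hp hg ∘ radialProj gM = radialProj gN ∘ PD := by
    funext z
    refine Subtype.ext ?_
    show cotangentLift p ⟨z.1.1, (conorm gM z.1.1 z.1.2)⁻¹ • z.1.2⟩ = _
    simp only [Function.comp_apply, radialProj, PD, hcon]
    rfl
  have hmap : ((symplecticVolume n M).comap Subtype.val).map PD
      = (Nat.card K : ℝ≥0∞) • (symplecticVolume n N).comap Subtype.val := by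
    ext B hB
    rw [Measure.map_apply hPD hB, eM.comap_apply,
      Measure.smul_apply, eN.comap_apply,
      ← Measure.smul_apply, ← map_cotangentLift_symplecticVolume hK hp,
      Measure.map_apply (continuous_cotangentLift hp).measurable
        (eN.measurableSet_image' hB)]
    congr 1
    ext z
    constructor
    · rintro ⟨w, hw, rfl⟩
      exact ⟨PD w, hw, rfl⟩
    · rintro ⟨w, hw, hwz⟩
      have hz : 0 < conorm gM z.1 z.2 ∧ conorm gM z.1 z.2 < 1 := by
        rw [← hcon, ← hwz]; exact w.2
      refine ⟨⟨z, hz⟩, ?_, rfl⟩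
      have : PD ⟨z, hz⟩ = w := Subtype.ext hwz.symm
      rw [mem_preimage, this]
      exact hw
  rw [liouvilleMeasure, liouvilleMeasure, Measure.map_smul,
    Measure.map_map (measurable_cosphereLift hp hg) (measurable_radialProj hmM), hcomm,
    ← Measure.map_map (measurable_radialProj hm) hPD, hmap, Measure.map_smul, smul_comm]

omit [IsManifold (𝓡 n) ∞ M] [IsManifold (𝓡 n) ∞ N] in
lemma cosphereLift_surjective {p : M → N} (hp : IsLocalDiffeomorph (𝓡 n) (𝓡 n) ∞ p)
    (hs : Function.Surjective p) {gM : FormField n M} {gN : FormField n N}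
    (hg : pullbackForm p gN = gM) : Function.Surjective (cosphereLift p hp hg) := by
  rintro ⟨w, hw⟩
  obtain ⟨z, rfl⟩ := cotangentLift_surjective hp hs w
  refine ⟨⟨z, ?_⟩, rfl⟩
  rwa [conorm_cotangentLift hp, hg] at hw

end Liouville

/-! ### Convolution kernels of intertwiners -/

section Kernel

variable {G : Type*} [Group G] {H₁ H₂ : Subgroup G} [Fintype (G ⧸ H₁)] [Fintype (G ⧸ H₂)]

/-- The inverse of a unitary intertwiner. -/
def UnitaryIntertwiner.symm (T : UnitaryIntertwiner H₁ H₂) : UnitaryIntertwiner H₂ H₁ where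
  toEquiv := T.toEquiv.symm
  map_quasiRegular a f := by
    rw [LinearIsometryEquiv.symm_apply_eq, T.map_quasiRegular, LinearIsometryEquiv.apply_symm_apply]

lemma UnitaryIntertwiner.card_quotient_eq (T : UnitaryIntertwiner H₁ H₂) :
    Fintype.card (G ⧸ H₁) = Fintype.card (G ⧸ H₂) := by
  have h := T.toEquiv.toLinearEquiv.finrank_eq
  rwa [finrank_euclideanSpace, finrank_euclideanSpace] at h

lemma UnitaryIntertwiner.card_subgroup_eq [Finite G] (T : UnitaryIntertwiner H₁ H₂) :
    Nat.card H₁ = Nat.card H₂ := by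
  have h₁ := Subgroup.card_eq_card_quotient_mul_card_subgroup H₁
  have h₂ := Subgroup.card_eq_card_quotient_mul_card_subgroup H₂
  rw [h₁, Nat.card_eq_fintype_card (α := G ⧸ H₁), Nat.card_eq_fintype_card (α := G ⧸ H₂),
    T.card_quotient_eq] at h₂
  exact Nat.eq_of_mul_eq_mul_left Fintype.card_pos h₂

variable [Fintype G]

omit [Fintype (G ⧸ H₁)] [Fintype (G ⧸ H₂)] in
open Classical in
/-- The sum over `G` of a kernel against a delta function at a coset. -/
lemma sum_kernel_mul_single (A : DoubleCoset.Quotient (H₂ : Set G) (H₁ : Set G) → ℂ) (x y : G) :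
    ∑ z : G, A (DoubleCoset.mk H₂ H₁ (x⁻¹ * z)) *
      (EuclideanSpace.single (y : G ⧸ H₁) (1 : ℂ)) (z : G ⧸ H₁)
      = Nat.card H₁ * A (DoubleCoset.mk H₂ H₁ (x⁻¹ * y)) := by
  have h1 : ∀ z : G, A (DoubleCoset.mk H₂ H₁ (x⁻¹ * z)) *
      (EuclideanSpace.single (y : G ⧸ H₁) (1 : ℂ)) (z : G ⧸ H₁)
      = if (z : G ⧸ H₁) = y then A (DoubleCoset.mk H₂ H₁ (x⁻¹ * y)) else 0 := by
    intro z
    rw [PiLp.single_apply]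
    split_ifs with h
    · rw [mul_one]
      congr 1
      have h2 := QuotientGroup.eq.1 h
      rw [DoubleCoset.eq]
      exact ⟨1, one_mem _, z⁻¹ * y, h2, by group⟩
    · rw [mul_zero]
  simp_rw [h1]
  rw [← Finset.sum_filter, Finset.sum_const, nsmul_eq_mul]
  congr 2
  rw [← Fintype.card_subtype, ← Nat.card_eq_fintype_card]
  refine Nat.card_congr ⟨fun z => ⟨y⁻¹ * z.1, QuotientGroup.eq.1 z.2.symm⟩,
    fun h => ⟨y * h.1, by simp [QuotientGroup.mk_mul_of_mem]⟩, fun z => ?_, fun h => ?_⟩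
  · simp
  · simp

/-- A unitary intertwiner has exactly one convolution kernel: its value at `a` is determined by
the image of the delta function at the base coset. -/
theorem existsUnique_isConvolutionKernel (T : UnitaryIntertwiner H₁ H₂) :
    ∃! A : DoubleCoset.Quotient (H₂ : Set G) (H₁ : Set G) → ℂ, IsConvolutionKernel T A := by
  classical
  have hcard : (Nat.card H₁ : ℂ) ≠ 0 := Nat.cast_ne_zero.2 Nat.card_pos.ne'
  have hq : ∀ a y : G, quasiRegular H₁ a (EuclideanSpace.single (y : G ⧸ H₁) (1 : ℂ))
      = EuclideanSpace.single ((a * y : G) : G ⧸ H₁) 1 := by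
    intro a y
    ext c
    simp only [quasiRegular, PiLp.single_apply]
    have : a⁻¹ • c = (y : G ⧸ H₁) ↔ c = ((a * y : G) : G ⧸ H₁) := by
      rw [inv_smul_eq_iff]; rfl
    simp only [this]
  set δ : EuclideanSpace ℂ (G ⧸ H₁) := EuclideanSpace.single ((1 : G) : G ⧸ H₁) (1 : ℂ) with hδ
  set k : EuclideanSpace ℂ (G ⧸ H₂) := T.toEquiv δ
  have hk : ∀ x y : G, T.toEquiv (EuclideanSpace.single (y : G ⧸ H₁) (1 : ℂ)) (x : G ⧸ H₂)
      = k ((y⁻¹ * x : G) : G ⧸ H₂) := by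
    intro x y
    have h := congrArg (fun f => f (x : G ⧸ H₂)) (T.map_quasiRegular y δ)
    rw [hδ, hq, mul_one] at h
    exact h
  have hkH : ∀ h ∈ H₁, ∀ x : G, k ((h * x : G) : G ⧸ H₂) = k (x : G ⧸ H₂) := by
    intro h hh x
    rw [show ((h * x : G) : G ⧸ H₂) = ((h⁻¹⁻¹ * x : G) : G ⧸ H₂) by rw [inv_inv], ← hk]
    have : ((h⁻¹ : G) : G ⧸ H₁) = ((1 : G) : G ⧸ H₁) := QuotientGroup.eq.2 (by simpa using hh)
    rw [this]
  -- `A(a) = k(a⁻¹H₂) / #H₁`, for `k` the image of the delta function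
  let A : DoubleCoset.Quotient (H₂ : Set G) (H₁ : Set G) → ℂ :=
    Quotient.lift (fun a : G => (Nat.card H₁ : ℂ)⁻¹ * k ((a⁻¹ : G) : G ⧸ H₂)) (by
      intro a b hab
      obtain ⟨h, hh, h', hh', rfl⟩ := DoubleCoset.rel_iff.1 hab
      have e : (((h * a * h')⁻¹ : G) : G ⧸ H₂) = ((h'⁻¹ * a⁻¹ : G) : G ⧸ H₂) :=
        QuotientGroup.eq.2 (by
          have : ((h * a * h')⁻¹)⁻¹ * (h'⁻¹ * a⁻¹) = h := by group
          rwa [this])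
      beta_reduce
      rw [e, hkH _ (inv_mem hh')])
  have hA : ∀ a : G, A (DoubleCoset.mk H₂ H₁ a) = (Nat.card H₁ : ℂ)⁻¹ * k ((a⁻¹ : G) : G ⧸ H₂) :=
    fun a => rfl
  refine ⟨A, ?_, ?_⟩
  · intro f x
    -- both sides are linear in `f`
    have hlin : ∀ f : EuclideanSpace ℂ (G ⧸ H₁),
        f = ∑ c, f c • EuclideanSpace.single c (1 : ℂ) := by
      intro f
      ext c
      simp [Pi.single_apply]
    have hx : ∀ c : G ⧸ H₁, T.toEquiv (EuclideanSpace.single c (1 : ℂ)) (x : G ⧸ H₂)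
        = ∑ z : G, A (DoubleCoset.mk H₂ H₁ (x⁻¹ * z)) *
          (EuclideanSpace.single c (1 : ℂ)) (z : G ⧸ H₁) := by
      intro c
      induction c using QuotientGroup.induction_on with
      | H y =>
        rw [sum_kernel_mul_single, hk, hA, mul_inv_cancel_left₀ hcard]
        group
    calc T.toEquiv f (x : G ⧸ H₂)
        = ∑ c, f c * T.toEquiv (EuclideanSpace.single c (1 : ℂ)) (x : G ⧸ H₂) := by
          conv_lhs => rw [hlin f, map_sum, WithLp.ofLp_sum, Finset.sum_apply]
          refine Finset.sum_congr rfl fun c _ => ?_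
          rw [map_smul]
          rfl
      _ = ∑ z : G, A (DoubleCoset.mk H₂ H₁ (x⁻¹ * z)) * f (z : G ⧸ H₁) := by
          simp_rw [hx, Finset.mul_sum]
          rw [Finset.sum_comm]
          refine Finset.sum_congr rfl fun z _ => ?_
          simp only [PiLp.single_apply, mul_ite, mul_one, mul_zero]
          rw [Finset.sum_ite_eq, if_pos (Finset.mem_univ _), mul_comm]
  · intro B hB
    funext q
    induction q using Quotient.inductionOn with
    | h a =>
      have h1 := hB (EuclideanSpace.single ((a : G) : G ⧸ H₁) 1) 1
      have h2 := sum_kernel_mul_single B 1 a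
      rw [h2, hk] at h1
      have h3 : B (DoubleCoset.mk H₂ H₁ a) = A (DoubleCoset.mk H₂ H₁ a) := by
        rw [hA]
        rw [mul_one, inv_one, one_mul] at h1
        rw [h1, inv_mul_cancel_left₀ hcard]
      exact h3

end Kernel

/-! ### Unitary operators from maps on functions -/

section L2

/-- A linear map `U` on functions that respects almost everywhere equality and `L²` norms is unitary
as soon as it has a right inverse `V` that preserves square integrability. -/
lemma isUnitaryOnL2_of_inverse {X Y : Type*} [MeasurableSpace X] [MeasurableSpace Y]
    {μ : Measure X} {ν : Measure Y} {U : (X → ℂ) → (Y → ℂ)} {V : (Y → ℂ) → (X → ℂ)}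
    (hadd : ∀ F F', U (F + F') = U F + U F') (hsmul : ∀ (c : ℂ) F, U (c • F) = c • U F)
    (hae : ∀ F F', F =ᵐ[μ] F' → U F =ᵐ[ν] U F')
    (hU : ∀ F, MemLp F 2 μ → MemLp (U F) 2 ν)
    (hnorm : ∀ F, MemLp F 2 μ → eLpNorm (U F) 2 ν = eLpNorm F 2 μ)
    (hV : ∀ K, MemLp K 2 ν → MemLp (V K) 2 μ) (hUV : ∀ K, U (V K) = K) :
    IsUnitaryOnL2 μ ν U := by
  have hspec : ∀ (F : X → ℂ) (hF : MemLp F 2 μ),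
      (hU _ (Lp.memLp (hF.toLp F))).toLp (U (hF.toLp F)) = (hU F hF).toLp (U F) :=
    fun F hF => (MemLp.toLp_eq_toLp_iff _ _).2 (hae _ _ hF.coeFn_toLp)
  let L : Lp ℂ 2 μ →ₗᵢ[ℂ] Lp ℂ 2 ν :=
    { toFun := fun f => (hU _ (Lp.memLp f)).toLp (U f)
      map_add' := fun f g => by
        rw [← MemLp.toLp_add, MemLp.toLp_eq_toLp_iff, ← hadd]
        exact hae _ _ (Lp.coeFn_add f g)
      map_smul' := fun c f => by
        rw [RingHom.id_apply, ← MemLp.toLp_const_smul, MemLp.toLp_eq_toLp_iff, ← hsmul]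
        exact hae _ _ (Lp.coeFn_smul c f)
      norm_map' := fun f => by
        show ‖(hU _ (Lp.memLp f)).toLp (U f)‖ = ‖f‖
        rw [Lp.norm_toLp, hnorm _ (Lp.memLp f), Lp.norm_def] }
  have hsurj : Function.Surjective L := by
    intro k
    refine ⟨(hV _ (Lp.memLp k)).toLp (V k), ?_⟩
    show (hU _ (Lp.memLp ((hV _ (Lp.memLp k)).toLp (V k)))).toLp _ = k
    rw [hspec]
    simp_rw [hUV]
    exact Lp.toLp_coeFn k (Lp.memLp k)
  refine ⟨LinearIsometryEquiv.ofSurjective L hsurj, fun F hF => ?_⟩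
  show (hU _ (Lp.memLp (hF.toLp F))).toLp (U (hF.toLp F)) =ᵐ[ν] U F
  rw [hspec]
  exact MemLp.coeFn_toLp _

end L2

/-! ### Measured quotients and kernel operators -/

section Quotient

variable {G : Type*} [Group G] {X Y Y₁ Y₂ : Type*} [MulAction G X]
  [MeasurableSpace X] [MeasurableSpace Y] [MeasurableSpace Y₁] [MeasurableSpace Y₂]
  {μ : Measure X} {ν : Measure Y} {ν₁ : Measure Y₁} {ν₂ : Measure Y₂}

/-- `q : X → Y` is a model of the quotient `H\X` as a measurable space, and `ν` is the quotient
measure, normalized as for a covering with `#H` sheets: `q` maps `μ` to `#H • ν`. -/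
structure IsMeasuredQuotient (H : Subgroup G) (q : X → Y) (μ : Measure X) (ν : Measure Y) :
    Prop where
  surjective : Function.Surjective q
  apply_eq_iff : ∀ x y, q x = q y ↔ ∃ h ∈ H, h • x = y
  measurable : Measurable q
  measurableSet_image : ∀ S, MeasurableSet S → MeasurableSet (q '' S)
  map_eq : μ.map q = (Nat.card H : ℝ≥0∞) • ν

namespace IsMeasuredQuotient

variable {H H₁ H₂ : Subgroup G} {q : X → Y} {q₁ : X → Y₁} {q₂ : X → Y₂}

lemma smul (h : IsMeasuredQuotient H q μ ν) (c : ℝ≥0∞) :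
    IsMeasuredQuotient H q (c • μ) (c • ν) where
  surjective := h.surjective
  apply_eq_iff := h.apply_eq_iff
  measurable := h.measurable
  measurableSet_image := h.measurableSet_image
  map_eq := by rw [Measure.map_smul, h.map_eq, smul_comm]

lemma measurable_of_comp (h : IsMeasuredQuotient H q μ ν) {Z : Type*} [MeasurableSpace Z]
    {f : Y → Z} (hf : Measurable (f ∘ q)) : Measurable f := fun B hB => by
  have := h.measurableSet_image _ (hf hB)
  rwa [preimage_comp, image_preimage_eq _ h.surjective] at this

lemma card_ne_zero [Finite G] (H : Subgroup G) : (Nat.card H : ℝ≥0∞) ≠ 0 :=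
  Nat.cast_ne_zero.2 Nat.card_pos.ne'

lemma ae_comp (h : IsMeasuredQuotient H q μ ν) {P : Y → Prop} (hP : ∀ᵐ y ∂ν, P y) :
    ∀ᵐ x ∂μ, P (q x) := by
  refine ae_of_ae_map h.measurable.aemeasurable ?_
  rw [h.map_eq]
  exact Measure.ae_smul_measure hP _

/-- A property holding almost everywhere upstairs holds almost everywhere downstairs: the saturation
of a null set is the union of its finitely many translates, hence a null set. -/
lemma ae_of_comp [Finite G] (h : IsMeasuredQuotient H q μ ν)
    (hμ : ∀ a : G, MeasurePreserving (a • · : X → X) μ μ)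
    {P : Y → Prop} (hP : ∀ᵐ x ∂μ, P (q x)) : ∀ᵐ y ∂ν, P y := by
  set N := toMeasurable μ {x | ¬ P (q x)}
  have hN : MeasurableSet N := measurableSet_toMeasurable _ _
  have hN0 : μ N = 0 := by rw [measure_toMeasurable]; exact hP
  have hsat : q ⁻¹' (q '' N) ⊆ ⋃ a : G, (a • · : X → X) ⁻¹' N := by
    rintro x ⟨y, hy, hyx⟩
    obtain ⟨a, -, rfl⟩ := (h.apply_eq_iff x y).1 hyx.symm
    exact mem_iUnion.2 ⟨a, hy⟩
  have h0 : μ (q ⁻¹' (q '' N)) = 0 := by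
    refine measure_mono_null hsat (measure_iUnion_null fun a => ?_)
    rw [(hμ a).measure_preimage hN.nullMeasurableSet, hN0]
  have hm := h.measurableSet_image N hN
  have h1 : (Nat.card H : ℝ≥0∞) * ν (q '' N) = 0 := by
    rw [← smul_eq_mul, ← Measure.smul_apply, ← h.map_eq, Measure.map_apply h.measurable hm, h0]
  have h2 : ν (q '' N) = 0 := (mul_eq_zero.1 h1).resolve_left (card_ne_zero H)
  refine measure_mono_null (fun y hy => ?_) h2
  obtain ⟨x, rfl⟩ := h.surjective y
  exact ⟨x, subset_toMeasurable _ _ hy, rfl⟩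

variable [Fintype G]

/-- The kernel operator of `A` on functions on the quotients,
`(U F)(q₂ x) = ∑ a, A(a) F(q₁(a⁻¹ x))`. It is written with an arbitrary section of `q₂`; the
choice does not matter, as `A` is left `H₂`-invariant: see `kernelOp_apply`. -/
def kernelOp (q₁ : X → Y₁) (h₂ : IsMeasuredQuotient H₂ q₂ μ ν₂)
    (A : DoubleCoset.Quotient (H₂ : Set G) (H₁ : Set G) → ℂ) (F : Y₁ → ℂ) (η : Y₂) : ℂ :=
  ∑ a : G, A (DoubleCoset.mk H₂ H₁ a) * F (q₁ (a⁻¹ • Function.surjInv h₂.surjective η))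

omit [MeasurableSpace Y₁] in
lemma kernelOp_apply (q₁ : X → Y₁) (h₂ : IsMeasuredQuotient H₂ q₂ μ ν₂)
    (A : DoubleCoset.Quotient (H₂ : Set G) (H₁ : Set G) → ℂ) (F : Y₁ → ℂ) (x : X) :
    kernelOp q₁ h₂ A F (q₂ x) = ∑ a : G, A (DoubleCoset.mk H₂ H₁ a) * F (q₁ (a⁻¹ • x)) := by
  obtain ⟨h, hh, hx⟩ := (h₂.apply_eq_iff x (Function.surjInv h₂.surjective (q₂ x))).1
    (Function.surjInv_eq h₂.surjective _).symm
  rw [kernelOp, ← hx]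
  refine Fintype.sum_equiv (Equiv.mulLeft h⁻¹) _ _ fun a => ?_
  have : DoubleCoset.mk H₂ H₁ (h⁻¹ * a) = DoubleCoset.mk H₂ H₁ a :=
    (DoubleCoset.eq _ _ _ _).2 ⟨h, hh, 1, one_mem _, by group⟩
  rw [Equiv.coe_mulLeft, this, mul_inv_rev, inv_inv, smul_smul]

/-- The function `yH ↦ F(q(y⁻¹x))` on `G/H`, for a function `F` on `H\X`. It is written with
chosen representatives of the cosets; see `orbitFun_apply` for the others. -/
def orbitFun (H : Subgroup G) (q : X → Y) (F : Y → ℂ) (x : X) : EuclideanSpace ℂ (G ⧸ H) :=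
  WithLp.toLp 2 fun c => F (q (c.out⁻¹ • x))

omit [Fintype G] in
lemma orbitFun_apply (h : IsMeasuredQuotient H q μ ν) (F : Y → ℂ) (x : X) (y : G) :
    orbitFun H q F x (y : G ⧸ H) = F (q (y⁻¹ • x)) := by
  obtain ⟨k, hk⟩ := QuotientGroup.mk_out_eq_mul H y
  show F (q ((y : G ⧸ H).out⁻¹ • x)) = _
  rw [hk]
  congr 1
  exact (h.apply_eq_iff _ _).2 ⟨k, k.2, by rw [smul_smul]; simp⟩

variable [Fintype (G ⧸ H)] [Fintype (G ⧸ H₁)] [Fintype (G ⧸ H₂)]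

/-- On each `G`-orbit the kernel operator is the intertwiner itself. -/
lemma orbitFun_kernelOp (h₁ : IsMeasuredQuotient H₁ q₁ μ ν₁) (h₂ : IsMeasuredQuotient H₂ q₂ μ ν₂)
    {T : UnitaryIntertwiner H₁ H₂} {A : DoubleCoset.Quotient (H₂ : Set G) (H₁ : Set G) → ℂ}
    (hA : IsConvolutionKernel T A) (F : Y₁ → ℂ) (x : X) :
    orbitFun H₂ q₂ (kernelOp q₁ h₂ A F) x = T.toEquiv (orbitFun H₁ q₁ F x) := by
  ext c
  induction c using QuotientGroup.induction_on with
  | H w =>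
    rw [h₂.orbitFun_apply, kernelOp_apply, hA]
    refine Fintype.sum_equiv (Equiv.mulLeft w) _ _ fun a => ?_
    rw [h₁.orbitFun_apply, Equiv.coe_mulLeft, inv_mul_cancel_left, mul_inv_rev, smul_smul]

omit [Fintype G] [Fintype (G ⧸ H)] in
lemma orbitFun_injective (h : IsMeasuredQuotient H q μ ν) {F F' : Y → ℂ}
    (hF : ∀ x, orbitFun H q F x = orbitFun H q F' x) : F = F' := by
  funext y
  obtain ⟨x, rfl⟩ := h.surjective y
  have h1 := congrArg (fun f => f ((1 : G) : G ⧸ H)) (hF x)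
  simpa [h.orbitFun_apply] using h1

lemma kernelOp_kernelOp (h₁ : IsMeasuredQuotient H₁ q₁ μ ν₁) (h₂ : IsMeasuredQuotient H₂ q₂ μ ν₂)
    {T : UnitaryIntertwiner H₁ H₂} {A : DoubleCoset.Quotient (H₂ : Set G) (H₁ : Set G) → ℂ}
    (hA : IsConvolutionKernel T A) {B : DoubleCoset.Quotient (H₁ : Set G) (H₂ : Set G) → ℂ}
    (hB : IsConvolutionKernel T.symm B) (K : Y₂ → ℂ) :
    kernelOp q₁ h₂ A (kernelOp q₂ h₁ B K) = K := by
  refine h₂.orbitFun_injective fun x => ?_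
  rw [orbitFun_kernelOp h₁ h₂ hA, orbitFun_kernelOp h₂ h₁ hB]
  exact T.toEquiv.apply_symm_apply _

omit [Fintype (G ⧸ H₁)] [Fintype (G ⧸ H₂)] in
lemma kernelOp_ae_congr (hμ : ∀ a : G, MeasurePreserving (a • · : X → X) μ μ)
    (h₁ : IsMeasuredQuotient H₁ q₁ μ ν₁) (h₂ : IsMeasuredQuotient H₂ q₂ μ ν₂)
    (A : DoubleCoset.Quotient (H₂ : Set G) (H₁ : Set G) → ℂ) {F F' : Y₁ → ℂ} (hF : F =ᵐ[ν₁] F') :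
    kernelOp q₁ h₂ A F =ᵐ[ν₂] kernelOp q₁ h₂ A F' := by
  refine h₂.ae_of_comp hμ ?_
  have h3 : ∀ᵐ x ∂μ, ∀ a : G, F (q₁ (a⁻¹ • x)) = F' (q₁ (a⁻¹ • x)) :=
    ae_all_iff.2 fun a => (hμ a⁻¹).quasiMeasurePreserving.ae (h₁.ae_comp hF)
  filter_upwards [h3] with x hx
  simp_rw [kernelOp_apply, hx]

omit [Fintype (G ⧸ H₁)] [Fintype (G ⧸ H₂)] in
lemma measurable_kernelOp (hμ : ∀ a : G, MeasurePreserving (a • · : X → X) μ μ)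
    (h₁ : IsMeasuredQuotient H₁ q₁ μ ν₁) (h₂ : IsMeasuredQuotient H₂ q₂ μ ν₂)
    (A : DoubleCoset.Quotient (H₂ : Set G) (H₁ : Set G) → ℂ) {F : Y₁ → ℂ} (hF : Measurable F) :
    Measurable (kernelOp q₁ h₂ A F) := by
  refine h₂.measurable_of_comp ?_
  have : kernelOp q₁ h₂ A F ∘ q₂
      = fun x => ∑ a : G, A (DoubleCoset.mk H₂ H₁ a) * F (q₁ (a⁻¹ • x)) :=
    funext fun x => kernelOp_apply q₁ h₂ A F x
  rw [this]
  refine Finset.measurable_sum _ fun a _ => measurable_const.mul ?_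
  exact hF.comp (h₁.measurable.comp (hμ a⁻¹).measurable)

omit [Fintype G] in
/-- The sum of `f` over the translates by `G/H` has integral `#G ∫ f`: each translate contributes
`#H ∫ f`. -/
lemma lintegral_sum_coset [Finite G] (hμ : ∀ a : G, MeasurePreserving (a • · : X → X) μ μ)
    (h : IsMeasuredQuotient H q μ ν) {f : Y → ℝ≥0∞} (hf : Measurable f) :
    ∫⁻ x, ∑ c : G ⧸ H, f (q (c.out⁻¹ • x)) ∂μ = Nat.card G * ∫⁻ y, f y ∂ν := by
  have h1 : ∀ c : G ⧸ H, ∫⁻ x, f (q (c.out⁻¹ • x)) ∂μ = Nat.card H * ∫⁻ y, f y ∂ν := by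
    intro c
    rw [(hμ c.out⁻¹).lintegral_comp (f := fun x => f (q x)) (hf.comp h.measurable),
      ← lintegral_map hf h.measurable, h.map_eq, lintegral_smul_measure, smul_eq_mul]
  have h2 : ∀ c : G ⧸ H, Measurable fun x => f (q (c.out⁻¹ • x)) := fun c =>
    hf.comp (h.measurable.comp (hμ c.out⁻¹).measurable)
  rw [lintegral_finsetSum _ fun c _ => h2 c]
  simp_rw [h1]
  rw [Finset.sum_const, Finset.card_univ, nsmul_eq_mul, ← mul_assoc,
    Subgroup.card_eq_card_quotient_mul_card_subgroup H, Nat.card_eq_fintype_card (α := G ⧸ H)]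
  push_cast
  rfl

lemma sum_enorm_sq {ι : Type*} [Fintype ι] (f : EuclideanSpace ℂ ι) :
    ∑ c, ‖f c‖ₑ ^ 2 = ‖f‖ₑ ^ 2 := by
  simp_rw [← ofReal_norm, ← ENNReal.ofReal_pow (norm_nonneg _)]
  rw [← ENNReal.ofReal_sum_of_nonneg fun _ _ => by positivity, EuclideanSpace.norm_sq_eq]

lemma lintegral_kernelOp (hμ : ∀ a : G, MeasurePreserving (a • · : X → X) μ μ)
    (h₁ : IsMeasuredQuotient H₁ q₁ μ ν₁) (h₂ : IsMeasuredQuotient H₂ q₂ μ ν₂)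
    {T : UnitaryIntertwiner H₁ H₂} {A : DoubleCoset.Quotient (H₂ : Set G) (H₁ : Set G) → ℂ}
    (hA : IsConvolutionKernel T A) {F : Y₁ → ℂ} (hF : Measurable F) :
    ∫⁻ y, ‖kernelOp q₁ h₂ A F y‖ₑ ^ 2 ∂ν₂ = ∫⁻ y, ‖F y‖ₑ ^ 2 ∂ν₁ := by
  have hpt : ∀ x, ∑ c : G ⧸ H₂, ‖kernelOp q₁ h₂ A F (q₂ (c.out⁻¹ • x))‖ₑ ^ 2
      = ∑ c : G ⧸ H₁, ‖F (q₁ (c.out⁻¹ • x))‖ₑ ^ 2 := by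
    intro x
    have h3 := sum_enorm_sq (orbitFun H₂ q₂ (kernelOp q₁ h₂ A F) x)
    have h4 := sum_enorm_sq (orbitFun H₁ q₁ F x)
    have h5 : ‖orbitFun H₂ q₂ (kernelOp q₁ h₂ A F) x‖ₑ = ‖orbitFun H₁ q₁ F x‖ₑ := by
      rw [orbitFun_kernelOp h₁ h₂ hA]
      exact T.toEquiv.toLinearIsometry.enorm_map _
    rw [h5, ← h4] at h3
    exact h3
  have e₂ := h₂.lintegral_sum_coset hμ ((measurable_kernelOp hμ h₁ h₂ A hF).enorm.pow_const 2)
  have e₁ := h₁.lintegral_sum_coset hμ (hF.enorm.pow_const 2)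
  simp_rw [hpt] at e₂
  rw [e₁] at e₂
  exact ((ENNReal.mul_right_inj (Nat.cast_ne_zero.2 Nat.card_pos.ne') (ENNReal.natCast_ne_top _)).1
    e₂).symm

lemma eLpNorm_two_eq {α : Type*} [MeasurableSpace α] {m : Measure α} (f : α → ℂ) :
    eLpNorm f 2 m = (∫⁻ x, ‖f x‖ₑ ^ 2 ∂m) ^ (1 / 2 : ℝ) := by
  rw [eLpNorm_eq_lintegral_rpow_enorm_toReal (by simp) (by simp)]
  simp

lemma kernelOp_memLp (hμ : ∀ a : G, MeasurePreserving (a • · : X → X) μ μ)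
    (h₁ : IsMeasuredQuotient H₁ q₁ μ ν₁) (h₂ : IsMeasuredQuotient H₂ q₂ μ ν₂)
    {T : UnitaryIntertwiner H₁ H₂} {A : DoubleCoset.Quotient (H₂ : Set G) (H₁ : Set G) → ℂ}
    (hA : IsConvolutionKernel T A) {F : Y₁ → ℂ} (hF : MemLp F 2 ν₁) :
    MemLp (kernelOp q₁ h₂ A F) 2 ν₂ ∧
      eLpNorm (kernelOp q₁ h₂ A F) 2 ν₂ = eLpNorm F 2 ν₁ := by
  obtain ⟨F', hF', hae⟩ := hF.1
  have hae' := kernelOp_ae_congr hμ h₁ h₂ A hae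
  have hn : eLpNorm (kernelOp q₁ h₂ A F) 2 ν₂ = eLpNorm F 2 ν₁ := by
    rw [eLpNorm_congr_ae hae', eLpNorm_congr_ae hae, eLpNorm_two_eq, eLpNorm_two_eq,
      lintegral_kernelOp hμ h₁ h₂ hA hF'.measurable]
  refine ⟨⟨⟨_, (measurable_kernelOp hμ h₁ h₂ A hF'.measurable).stronglyMeasurable, hae'⟩, ?_⟩, hn⟩
  rw [hn]
  exact hF.2

/-- The kernel operator of a unitary intertwiner is unitary; its inverse is the kernel operator of
the inverse intertwiner. -/
theorem isUnitaryOnL2_kernelOp (hμ : ∀ a : G, MeasurePreserving (a • · : X → X) μ μ)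
    (h₁ : IsMeasuredQuotient H₁ q₁ μ ν₁) (h₂ : IsMeasuredQuotient H₂ q₂ μ ν₂)
    {T : UnitaryIntertwiner H₁ H₂} {A : DoubleCoset.Quotient (H₂ : Set G) (H₁ : Set G) → ℂ}
    (hA : IsConvolutionKernel T A) : IsUnitaryOnL2 ν₁ ν₂ (kernelOp q₁ h₂ A) := by
  obtain ⟨B, hB, -⟩ := existsUnique_isConvolutionKernel T.symm
  refine isUnitaryOnL2_of_inverse (V := kernelOp q₂ h₁ B) (fun F F' => ?_) (fun c F => ?_)
    (fun F F' hF => kernelOp_ae_congr hμ h₁ h₂ A hF)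
    (fun F hF => (kernelOp_memLp hμ h₁ h₂ hA hF).1)
    (fun F hF => (kernelOp_memLp hμ h₁ h₂ hA hF).2)
    (fun K hK => (kernelOp_memLp hμ h₂ h₁ hB hK).1) (kernelOp_kernelOp h₁ h₂ hA hB)
  · funext η
    simp only [kernelOp, Pi.add_apply, mul_add, Finset.sum_add_distrib]
  · funext η
    simp only [kernelOp, Pi.smul_apply, smul_eq_mul, Finset.mul_sum]
    exact Finset.sum_congr rfl fun a _ => by ring

end IsMeasuredQuotient

end Quotient

/-! ### Lifted deck transformations -/

section Deck

variable {n : ℕ} {G : Type*} [Group G]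
  {M : Type*} [TopologicalSpace M] [ChartedSpace (EuclideanSpace ℝ (Fin n)) M]
  {N : Type*} [TopologicalSpace N] [ChartedSpace (EuclideanSpace ℝ (Fin n)) N]

/-- A homeomorphism is a quotient covering map for the trivial group; so statements on lifts of
quotient coverings apply to deck transformations. -/
lemma isQuotientCoveringMap_homeomorph {X : Type*} [TopologicalSpace X] [MulAction G X]
    (φ : X ≃ₜ X) : IsQuotientCoveringMap φ (⊥ : Subgroup G) where
  toIsQuotientMap := φ.isQuotientMap
  continuous_const_smul k := by
    obtain rfl := Subsingleton.elim k 1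
    simpa using continuous_id'
  apply_eq_iff_mem_orbit {x y} := by
    rw [φ.injective.eq_iff]
    refine ⟨fun h => h ▸ MulAction.mem_orbit_self x, ?_⟩
    rintro ⟨k, rfl⟩
    obtain rfl := Subsingleton.elim k 1
    simp
  disjoint _ := ⟨univ, univ_mem, fun k _ => Subsingleton.elim k 1⟩

variable [IsManifold (𝓡 n) ∞ M] [IsManifold (𝓡 n) ∞ N] [MulAction G M]

/-- The lift of a smooth covering `M → H\M` to the cosphere bundles is a quotient by `H`, as a map
of measure spaces, for any action of `G` on `S^*M` by lifted deck transformations. -/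
lemma isMeasuredQuotient_cosphereLift [SecondCountableTopology M] {H : Subgroup G} [Finite H]
    {p : M → N} (hH : IsQuotientCoveringMap p H) (hp : IsLocalDiffeomorph (𝓡 n) (𝓡 n) ∞ p)
    {gM : FormField n M} {gN : FormField n N} (hg : pullbackForm p gN = gM)
    (hm : Measurable fun z : CotangentBundle n N => conorm gN z.1 z.2)
    (hdiff : ∀ a : G, IsLocalDiffeomorph (𝓡 n) (𝓡 n) ∞ (fun x : M => a • x))
    [MulAction G (CosphereBundle gM)]
    (hact : ∀ (a : G) (z : CosphereBundle gM),
      (a • z).1 = cotangentLift (fun x : M => a • x) z.1) :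
    IsMeasuredQuotient H (cosphereLift p hp hg) (liouvilleMeasure gM) (liouvilleMeasure gN) where
  surjective := cosphereLift_surjective hp hH.surjective hg
  measurable := measurable_cosphereLift hp hg
  measurableSet_image _ hS := measurableSet_image_cosphereLift hp hg hm hS
  map_eq := map_cosphereLift_liouvilleMeasure hH hp hg hm
  apply_eq_iff z w := by
    have hdeck : ∀ h ∈ H, ∀ z : CosphereBundle gM,
        cotangentLift p (h • z).1 = cotangentLift p z.1 := by
      intro h hh z
      rw [hact, ← cotangentLift_comp (hp _) (hdiff h _)]
      congr 1
      exact funext fun x => hH.map_smul (⟨h, hh⟩ : H)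
    constructor
    · intro h
      have h1 : cotangentLift p z.1 = cotangentLift p w.1 := congrArg Subtype.val h
      have h2 : p w.1.1 = p z.1.1 := (congrArg TotalSpace.proj h1).symm
      obtain ⟨⟨k, hk⟩, hkz⟩ := hH.apply_eq_iff_mem_orbit.1 h2
      refine ⟨k, hk, Subtype.ext ?_⟩
      refine cotangentLift_injOn hp (injOn_singleton p w.1.1) ?_ rfl ((hdeck k hk z).trans h1)
      show (k • z).1.1 = w.1.1
      rw [hact]
      exact hkz
    · rintro ⟨k, hk, rfl⟩
      exact Subtype.ext (hdeck k hk z).symm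

end Deck

/-! ### The lifted Radon transform -/

namespace CoverDiagram

variable {n : ℕ} {G : Type*} [Group G] {H₁ H₂ : Subgroup G} {M M₁ M₂ M₀ : Type*}
  [TopologicalSpace M] [ChartedSpace (EuclideanSpace ℝ (Fin n)) M] [MulAction G M]
  [TopologicalSpace M₁] [ChartedSpace (EuclideanSpace ℝ (Fin n)) M₁]
  [TopologicalSpace M₂] [ChartedSpace (EuclideanSpace ℝ (Fin n)) M₂]
  [TopologicalSpace M₀] [ChartedSpace (EuclideanSpace ℝ (Fin n)) M₀]
  (D : CoverDiagram n H₁ H₂ M M₁ M₂ M₀) (g₀ : FormField n M₀)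

/-- The action of `G` on `S^*M` by lifted deck transformations. -/
@[reducible] def deckAction : MulAction G (CosphereBundle (D.metric g₀)) where
  smul a z := D.liftDeck g₀ a z
  one_smul z := by
    refine Subtype.ext ?_
    show cotangentLift (fun x : M => (1 : G) • x) z.1 = z.1
    simp_rw [one_smul]
    exact cotangentLift_id z.1
  mul_smul a b z := by
    refine Subtype.ext ?_
    show cotangentLift (fun x : M => (a * b) • x) z.1
      = cotangentLift (fun x : M => a • x) (cotangentLift (fun x : M => b • x) z.1)
    rw [← cotangentLift_comp (D.smul_diffeo a _) (D.smul_diffeo b _)]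
    simp_rw [mul_smul]
    rfl

lemma radon_eq_kernelOp [Fintype G] [IsManifold (𝓡 n) ∞ M] [IsManifold (𝓡 n) ∞ M₂]
    {μ : Measure (CosphereBundle (D.metric g₀))}
    {ν : Measure (CosphereBundle (D.metric₂ g₀))}
    (h₂ : letI := D.deckAction g₀; IsMeasuredQuotient H₂ (D.lift₂ g₀) μ ν)
    (hcard : Nat.card H₁ = Nat.card H₂)
    (A : DoubleCoset.Quotient (H₂ : Set G) (H₁ : Set G) → ℂ) :
    letI := D.deckAction g₀
    D.radon g₀ A = IsMeasuredQuotient.kernelOp (D.lift₁ g₀) h₂ A := by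
  let := D.deckAction g₀
  have := Fintype.ofFinite H₂
  funext F η
  obtain ⟨s, rfl⟩ := h₂.surjective η
  -- the fibre of `s` is parametrized by `H₂`, as `G` acts freely
  have hpush : ∀ f : CosphereBundle (D.metric g₀) → ℂ,
      D.pushforward₂ g₀ f (D.lift₂ g₀ s) = ∑ h : H₂, f ((h : G) • s) := by
    intro f
    have hinj : Function.Injective fun h : H₂ => (h : G) • s := by
      intro h k hhk
      have h1 : (h : G) • s.1.1 = (k : G) • s.1.1 :=
        congrArg (fun z : CosphereBundle (D.metric g₀) => z.1.1) hhk
      have := D.cover.isCancelSMul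
      exact Subtype.ext (IsCancelSMul.right_cancel _ _ _ h1)
    have hrange : {ζ | D.lift₂ g₀ ζ = D.lift₂ g₀ s} = range fun h : H₂ => (h : G) • s := by
      ext ζ
      rw [mem_ofPred_eq, eq_comm, h₂.apply_eq_iff]
      simp
    have h2 : D.pushforward₂ g₀ f (D.lift₂ g₀ s)
        = ∑ᶠ ζ ∈ {ζ | D.lift₂ g₀ ζ = D.lift₂ g₀ s}, f ζ := rfl
    rw [h2, hrange, finsum_mem_range hinj, finsum_eq_sum_of_fintype]
  have hcard' : (Nat.card H₁ : ℂ) ≠ 0 := Nat.cast_ne_zero.2 Nat.card_pos.ne'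
  have hker : ∀ h : H₂, ∑ a : G, A (DoubleCoset.mk H₂ H₁ a) *
      F (D.lift₁ g₀ (a⁻¹ • (h : G) • s))
      = IsMeasuredQuotient.kernelOp (D.lift₁ g₀) h₂ A F (D.lift₂ g₀ s) := by
    intro h
    have : D.lift₂ g₀ s = D.lift₂ g₀ ((h : G) • s) := (h₂.apply_eq_iff _ _).2 ⟨h, h.2, rfl⟩
    rw [this, IsMeasuredQuotient.kernelOp_apply]
  have hsum : ∑ a : G, A (DoubleCoset.mk H₂ H₁ a) *
      D.pushforward₂ g₀ (D.translate g₀ a (D.pullback₁ g₀ F)) (D.lift₂ g₀ s)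
      = ∑ h : H₂, ∑ a : G, A (DoubleCoset.mk H₂ H₁ a) *
        F (D.lift₁ g₀ (a⁻¹ • (h : G) • s)) := by
    simp_rw [hpush, Finset.mul_sum]
    exact Finset.sum_comm
  rw [radon, hsum]
  simp_rw [hker]
  rw [Finset.sum_const, Finset.card_univ, nsmul_eq_mul, ← Nat.card_eq_fintype_card, ← hcard,
    inv_mul_cancel_left₀ hcard']

end CoverDiagram
end FiniteRadon

end

open FiniteRadon in
theorem proposition3p1 {n : ℕ} {G : Type*} [Group G] [Fintype G] (H₁ H₂ : Subgroup G)
    [Fintype (G ⧸ H₁)] [Fintype (G ⧸ H₂)]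
    {M M₁ M₂ M₀ : Type*}
    [TopologicalSpace M] [T2Space M] [CompactSpace M]
    [ChartedSpace (EuclideanSpace ℝ (Fin n)) M] [IsManifold (𝓡 n) ∞ M] [MulAction G M]
    [TopologicalSpace M₁] [T2Space M₁] [CompactSpace M₁]
    [ChartedSpace (EuclideanSpace ℝ (Fin n)) M₁] [IsManifold (𝓡 n) ∞ M₁]
    [TopologicalSpace M₂] [T2Space M₂] [CompactSpace M₂]
    [ChartedSpace (EuclideanSpace ℝ (Fin n)) M₂] [IsManifold (𝓡 n) ∞ M₂]
    [TopologicalSpace M₀] [T2Space M₀] [CompactSpace M₀] [ConnectedSpace M₀]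
    [ChartedSpace (EuclideanSpace ℝ (Fin n)) M₀] [IsManifold (𝓡 n) ∞ M₀]
    (D : CoverDiagram n H₁ H₂ M M₁ M₂ M₀)
    (g₀ : Bundle.ContMDiffRiemannianMetric (𝓡 n) ∞ (EuclideanSpace ℝ (Fin n))
      (fun x : M₀ => TangentSpace (𝓡 n) x))
    (T : UnitaryIntertwiner H₁ H₂) :
    (∃! A : DoubleCoset.Quotient (H₂ : Set G) (H₁ : Set G) → ℂ, IsConvolutionKernel T A) ∧
    ∀ A : DoubleCoset.Quotient (H₂ : Set G) (H₁ : Set G) → ℂ, IsConvolutionKernel T A →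
      IsUnitaryOnL2 (liouvilleMeasure (D.metric₁ fun x v w => g₀.inner x v w))
        (liouvilleMeasure (D.metric₂ fun x v w => g₀.inner x v w))
        (D.radon (fun x v w => g₀.inner x v w) A) ∧
      IsUnitaryOnL2 (normalizedLiouvilleMeasure (D.metric₁ fun x v w => g₀.inner x v w))
        (normalizedLiouvilleMeasure (D.metric₂ fun x v w => g₀.inner x v w))
        (D.radon (fun x v w => g₀.inner x v w) A) := by
  refine ⟨existsUnique_isConvolutionKernel T, fun A hA => ?_⟩
  set g : FormField n M₀ := fun x v w => g₀.inner x v w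
  have : SecondCountableTopology M :=
    ChartedSpace.secondCountable_of_sigmaCompact (EuclideanSpace ℝ (Fin n)) M
  have hm := measurable_conorm g₀
  let := D.deckAction g
  have h₁ : IsMeasuredQuotient H₁ (D.lift₁ g) (liouvilleMeasure (D.metric g))
      (liouvilleMeasure (D.metric₁ g)) :=
    isMeasuredQuotient_cosphereLift D.cover₁ D.proj₁_diffeo _
      (measurable_conorm_pullbackForm D.sub₁_diffeo hm) D.smul_diffeo fun _ _ => rfl
  have h₂ : IsMeasuredQuotient H₂ (D.lift₂ g) (liouvilleMeasure (D.metric g))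
      (liouvilleMeasure (D.metric₂ g)) :=
    isMeasuredQuotient_cosphereLift D.cover₂ D.proj₂_diffeo _
      (measurable_conorm_pullbackForm D.sub₂_diffeo hm) D.smul_diffeo fun _ _ => rfl
  have hμ : ∀ a : G, MeasurePreserving (fun z : CosphereBundle (D.metric g) => a • z)
      (liouvilleMeasure (D.metric g)) (liouvilleMeasure (D.metric g)) := by
    intro a
    have := D.cover.toContinuousConstSMul
    have hg := pullbackForm_comp (D.proj_smul a) D.proj_diffeo (D.smul_diffeo a) g
    refine ⟨measurable_cosphereLift (D.smul_diffeo a) hg, ?_⟩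
    have h := map_cosphereLift_liouvilleMeasure
      (isQuotientCoveringMap_homeomorph (G := G) (Homeomorph.smul a : M ≃ₜ M)) (D.smul_diffeo a) hg
      (measurable_conorm_pullbackForm D.proj_diffeo hm)
    rw [Subgroup.card_bot, Nat.cast_one, one_smul] at h
    exact h
  have hcard := T.card_subgroup_eq
  rw [D.radon_eq_kernelOp g h₂ hcard A]
  refine ⟨IsMeasuredQuotient.isUnitaryOnL2_kernelOp hμ h₁ h₂ hA, ?_⟩
  -- the total masses agree since `#H₁ = #H₂`, so both measures are scaled by the same factor
  have hmass : liouvilleMeasure (D.metric₁ g) Set.univ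
      = liouvilleMeasure (D.metric₂ g) Set.univ := by
    have e₁ := congrArg (fun ν => ν Set.univ) h₁.map_eq
    have e₂ := congrArg (fun ν => ν Set.univ) h₂.map_eq
    simp only [Measure.map_apply h₁.measurable .univ, Measure.map_apply h₂.measurable .univ,
      Set.preimage_univ, Measure.smul_apply, smul_eq_mul, ← hcard] at e₁ e₂
    exact (ENNReal.mul_right_inj (Nat.cast_ne_zero.2 Nat.card_pos.ne')
      (ENNReal.natCast_ne_top _)).1 (e₁.symm.trans e₂)
  rw [normalizedLiouvilleMeasure, normalizedLiouvilleMeasure, ← hmass]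
  exact IsMeasuredQuotient.isUnitaryOnL2_kernelOp
    (fun a => (hμ a).smul_measure (liouvilleMeasure (D.metric₁ g) Set.univ)⁻¹)
    (h₁.smul _) (h₂.smul _) hA
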